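/- Let $M$ be an o-minimal expansion of an ordered field and let $k\in\mathbb N$. For affinely independent points $a_0,\dots,a_n\in M^k$, the open simplex $\sigma=(a_0,\dots,a_n)$ with vertices $a_0,\dots,a_n$ is the set of all $\sum_i\lambda_i a_i$ with $\lambda_i\in M$, $\lambda_i>0$ and $\sum_i\lambda_i=1$; its closure $\bar\sigma$ is obtained by allowing $\lambda_i\ge 0$. A simplicial complex in $M^k$ is a finite collection $P$ of open simplexes such that for all $\sigma,\theta\in P$ the set $\bar\sigma\cap\bar\theta$ is either empty or the closure of a common face of $\sigma$ and $\theta$ ($P$ need not contain the faces of its simplexes). Its realization $|P|\subseteq M^k$ is the union of its simplexes, with the topology induced by the order of $M$; its vertices are the vertices of its simplexes. A complex $L$ is a subdivision of $P$ if $|L|=|P|$ and every simplex of $L$ is contained in a simplex of $P$. A simplicial homeomorphism $\psi:|L|\to|L'|$ is a homeomorphism induced by a bijection from the vertices of $L$ to those of $L'$ under which the simplexes of $L$ correspond exactly to the simplexes of $L'$, $\psi$ preserving barycentric coordinates; it fixes a vertex if the underlying bijection does. A point of $M^k$ is real algebraic if its coordinates are algebraic over $\mathbb Q$. Let $P$ be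 a simplicial complex in $M^k$ all of whose vertices are real algebraic, and let $L$ be a subdivision of $P$. Then there is a subdivision $L'$ of $P$ such that: 1. all vertices of $L'$ are real algebraic; 2. there is a simplicial homeomorphism $\psi:|L|\to|L'|$ which fixes all the real algebraic vertices of $L$. Moreover, if every nonempty intersection of the closures of two simplexes of $L$ is the closure of a common face that itself belongs to $L$, then $L'$ has the same property. -/

import Mathlib

universe u v w

/-- Let `M` be an ordered field carrying a structure for a first-order language `𝓛`.
`IsOMinimalExpansion 𝓛 M` says that this structure is an o-minimal expansion of the ordered
field `M`: order, addition and multiplication are definable without parameters, and every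
subset of `M` definable with parameters from `M` is a finite union of points and of open
intervals with endpoints in `M ∪ {±∞}`. -/
structure IsOMinimalExpansion (𝓛 : FirstOrder.Language.{u, v}) (M : Type w)
    [Field M] [LinearOrder M] [𝓛.Structure M] : Prop where
  definable_le : (∅ : Set M).Definable 𝓛 {x : Fin 2 → M | x 0 ≤ x 1}
  definable_add : (∅ : Set M).Definable 𝓛 {x : Fin 3 → M | x 0 + x 1 = x 2}
  definable_mul : (∅ : Set M).Definable 𝓛 {x : Fin 3 → M | x 0 * x 1 = x 2}
  oMinimal : ∀ S : Set M, (Set.univ : Set M).Definable₁ 𝓛 S →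
    ∃ F : Set (Set M), F.Finite ∧ S = ⋃₀ F ∧
      ∀ I ∈ F, (∃ a, I = {a}) ∨ (∃ a b, I = Set.Ioo a b) ∨ (∃ a, I = Set.Iio a) ∨
        (∃ a, I = Set.Ioi a) ∨ I = Set.univ

section Complexes

variable {M : Type w} [Field M] [LinearOrder M] {k : ℕ}

/-- The open simplex with vertex set `s` (if `s` is a single point, it is that point). -/
def openSimplex (s : Finset (Fin k → M)) : Set (Fin k → M) :=
  {x | ∃ c : (Fin k → M) → M, (∀ a ∈ s, 0 < c a) ∧ ∑ a ∈ s, c a = 1 ∧ ∑ a ∈ s, c a • a = x}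

/-- The closed simplex with vertex set `s`. -/
def closedSimplex (s : Finset (Fin k → M)) : Set (Fin k → M) :=
  {x | ∃ c : (Fin k → M) → M, (∀ a ∈ s, 0 ≤ c a) ∧ ∑ a ∈ s, c a = 1 ∧ ∑ a ∈ s, c a • a = x}

variable (M k) in
/-- A simplicial complex in `M ^ k` in the sense of o-minimal geometry: a finite collection of
open simplexes, each given by its nonempty affinely independent vertex set, such that the
closures of any two of them are disjoint or meet in the closure of a common face. The complex
need not contain the faces of its simplexes. -/
structure OpenComplex where
  simplexes : Finset (Finset (Fin k → M))
  nonempty : ∀ s ∈ simplexes, s.Nonempty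
  indep : ∀ s ∈ simplexes, AffineIndependent M ((↑) : s → (Fin k → M))
  inter : ∀ s ∈ simplexes, ∀ t ∈ simplexes,
    closedSimplex s ∩ closedSimplex t = ∅ ∨
      ∃ r : Finset (Fin k → M), r.Nonempty ∧ r ⊆ s ∧ r ⊆ t ∧
        closedSimplex s ∩ closedSimplex t = closedSimplex r

namespace OpenComplex

/-- The common faces in which closures of simplexes of `P` meet belong to `P`. -/
def ContainsIntersections (P : OpenComplex M k) : Prop :=
  ∀ s ∈ P.simplexes, ∀ t ∈ P.simplexes,
    closedSimplex s ∩ closedSimplex t = ∅ ∨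
      ∃ r ∈ P.simplexes, r ⊆ s ∧ r ⊆ t ∧ closedSimplex s ∩ closedSimplex t = closedSimplex r

/-- The vertices of the simplexes of `P` (they need not be simplexes of `P`). -/
def vertices (P : OpenComplex M k) : Set (Fin k → M) :=
  {a | ∃ s ∈ P.simplexes, a ∈ s}

/-- The geometric realization `|P|`: the union of the open simplexes of `P`. -/
def realization (P : OpenComplex M k) : Set (Fin k → M) :=
  ⋃ s ∈ P.simplexes, openSimplex s

/-- `L` is a subdivision of `P`. -/
def IsSubdivision (L P : OpenComplex M k) : Prop :=
  L.realization = P.realization ∧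
    ∀ s ∈ L.simplexes, ∃ t ∈ P.simplexes, openSimplex s ⊆ openSimplex t

end OpenComplex

/-- A point of `M ^ k` with real algebraic coordinates. As `M` is an ordered field, the real
algebraic numbers in `M` are its elements algebraic over `ℚ`. -/
def IsAlgebraicPoint [IsStrictOrderedRing M] (a : Fin k → M) : Prop :=
  ∀ i, IsAlgebraic ℚ (a i)

/-- `P` is defined over the real algebraic numbers. -/
def OpenComplex.DefinedOverAlg [IsStrictOrderedRing M] (P : OpenComplex M k) : Prop :=
  ∀ a ∈ P.vertices, IsAlgebraicPoint a

/-- A simplicial homeomorphism `|L| → |L'|`: a homeomorphism induced by a bijection of the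
vertices that matches the simplexes of `L` with those of `L'`. On the part of the closure of each
simplex of `L` that lies in `|L|` it is given by the same barycentric coordinates; in particular
it agrees with `vertexMap` at every vertex that lies in `|L|`. -/
structure SimplicialHomeomorph [TopologicalSpace M] (L L' : OpenComplex M k) where
  toHomeomorph : L.realization ≃ₜ L'.realization
  vertexMap : (Fin k → M) → (Fin k → M)
  bijOn : Set.BijOn vertexMap L.vertices L'.vertices
  simplexes_iff : ∀ s : Finset (Fin k → M), (s : Set (Fin k → M)) ⊆ L.vertices →
    (s ∈ L.simplexes ↔ s.image vertexMap ∈ L'.simplexes)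
  map_eq : ∀ s ∈ L.simplexes, ∀ c : (Fin k → M) → M, (∀ a ∈ s, 0 ≤ c a) → ∑ a ∈ s, c a = 1 →
    ∀ x : L.realization, (x : Fin k → M) = ∑ a ∈ s, c a • a →
      (toHomeomorph x : Fin k → M) = ∑ a ∈ s, c a • vertexMap a

end Complexes

/-! The vertices of `L` and `P` together form one point of a power of `M`. Everything to be
preserved (coincidences, affine independence, intersections of closed simplexes, unions and
inclusions of open ones) is a first-order condition on that point in the language of ordered rings.
O-minimality makes `M` real closed (`IsOMinimalExpansion.polyIVT`), and its real algebraic elements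
then form a real closed field as well. Tarski's transfer yields a real algebraic point satisfying
the same condition, the coordinates that are already algebraic being kept as parameters. The
vertices of `P` do not move, so the moved copy of `L` still subdivides `P`, and affine extension of
the vertex map is the homeomorphism.

Transfer rests on an elimination of Cohen–Hörmander type, run in two real closed fields at once. For
a finite set of polynomials closed under derivatives, tails and pseudo-remainders, the signs of the
leading coefficients determine an order-preserving matching of roots in the two fields, and points
in matching positions give every polynomial the same sign (`exists_corr_of_isRemainderClosed`;
`exists_refinement` adds the roots of one polynomial). Iteration over the variables gives
`exists_sameSigns_sum`. With the same field twice it eliminates quantifiers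
(`isSemialg_exists_fun`); with `M` and its algebraic elements it moves points
(`PolyIVT.exists_isAlgebraic_sameSigns`). -/

set_option linter.unusedSectionVars false

/-! ### Polynomials over a real closed field: monotonicity from the derivative -/

section PolynomialOrder

open Polynomial

/-- Polynomials over the ordered field `R` have the intermediate value property. For ordered
fields this is equivalent to being real closed. -/
def PolyIVT (R : Type*) [Field R] [LinearOrder R] : Prop :=
  ∀ (p : R[X]) (a b : R), a < b → p.eval a < 0 → 0 < p.eval b → ∃ c, a < c ∧ c < b ∧ p.eval c = 0

variable {R : Type*} [Field R] [LinearOrder R] [IsStrictOrderedRing R]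

theorem PolyIVT.exists_root_of_pos_of_neg (hR : PolyIVT R) (p : R[X]) {a b : R} (hab : a < b)
    (ha : 0 < p.eval a) (hb : p.eval b < 0) : ∃ c, a < c ∧ c < b ∧ p.eval c = 0 := by
  obtain ⟨c, h1, h2, h3⟩ := hR (-p) a b hab (by simpa using ha) (by simpa using hb)
  exact ⟨c, h1, h2, by simpa using h3⟩

/-- Horner's form `p = divX p * X + p(0)` lowers the degree; once `divX p` exceeds `1`, the product
exceeds `x`. -/
theorem Polynomial.exists_forall_gt_lt_eval (p : R[X]) (hd : 0 < p.natDegree)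
    (hl : 0 < p.leadingCoeff) (C : R) : ∃ B, ∀ x, B < x → C < p.eval x := by
  induction hn : p.natDegree using Nat.strong_induction_on generalizing p C with
  | _ n ih =>
    have hp := Polynomial.divX_mul_X_add p
    have he : ∀ x, p.eval x = p.divX.eval x * x + p.coeff 0 := fun x => by
      conv_lhs => rw [← hp]
      simp
    have hdeg : p.divX.natDegree = p.natDegree - 1 := Polynomial.natDegree_divX_eq_natDegree_tsub_one
    have hlead : p.divX.leadingCoeff = p.leadingCoeff := by
      rw [leadingCoeff, leadingCoeff, hdeg, coeff_divX]
      congr 1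
      omega
    rcases Nat.eq_zero_or_pos p.divX.natDegree with h0 | h0
    · have hc := Polynomial.eq_C_of_natDegree_eq_zero h0
      have hcl : p.divX.coeff 0 = p.leadingCoeff := by rw [← hlead, leadingCoeff, h0]
      refine ⟨(C - p.coeff 0) / p.leadingCoeff, fun x hx => ?_⟩
      rw [he, hc, eval_C, hcl]
      rw [div_lt_iff₀ hl] at hx
      linarith
    · obtain ⟨B, hB⟩ := ih _ (by omega) p.divX h0 (hlead ▸ hl) 1 rfl
      refine ⟨max B (max 0 (C - p.coeff 0)), fun x hx => ?_⟩
      have h1 := hB x (lt_of_le_of_lt (le_max_left _ _) hx)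
      have h2 : 0 < x := lt_of_le_of_lt ((le_max_left _ _).trans (le_max_right _ _)) hx
      have h3 : C - p.coeff 0 < x :=
        lt_of_le_of_lt ((le_max_right _ _).trans (le_max_right _ _)) hx
      rw [he]
      nlinarith

theorem Polynomial.exists_forall_abs_sub_lt_eval_pos (p : R[X]) (r : R) (h : 0 < p.eval r) :
    ∃ ε > 0, ∀ y, |y - r| < ε → 0 < p.eval y := by
  let : TopologicalSpace R := Preorder.topology R
  have : OrderTopology R := ⟨rfl⟩
  have hc : ContinuousAt (fun x => p.eval x) r := p.continuous.continuousAt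
  obtain ⟨ε, hε, hh⟩ := (nhds_basis_abs_sub_lt r).eventually_iff.1
    (hc.eventually (lt_mem_nhds h))
  exact ⟨ε, hε, fun y hy => hh hy⟩

/-- Write `p = (X - r) q`; then `q(r) = p'(r) > 0`, so near `r` the sign of `p` is that of `x - r`.
-/
theorem Polynomial.exists_eval_of_root_of_derivative_pos (p : R[X]) {r u : R}
    (hr : p.eval r = 0) (hd : 0 < p.derivative.eval r) :
    (u < r → ∃ w, u < w ∧ w < r ∧ p.eval w < 0) ∧
      (r < u → ∃ w, r < w ∧ w < u ∧ 0 < p.eval w) := by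
  obtain ⟨q, rfl⟩ := Polynomial.dvd_iff_isRoot.2 hr
  have hq : 0 < q.eval r := by simpa [derivative_mul] using hd
  obtain ⟨ε, hε, hh⟩ := q.exists_forall_abs_sub_lt_eval_pos r hq
  constructor
  · intro hu
    obtain ⟨w, h1, h2⟩ := exists_between (max_lt hu (sub_lt_self r hε))
    rw [max_lt_iff] at h1
    have := hh w (by rw [abs_lt]; constructor <;> linarith [h1.2])
    refine ⟨w, h1.1, h2, ?_⟩
    simp only [eval_mul, eval_sub, eval_X, eval_C]
    exact mul_neg_of_neg_of_pos (by linarith) this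
  · intro hu
    obtain ⟨w, h1, h2⟩ := exists_between (lt_min hu (lt_add_of_pos_right r hε))
    rw [lt_min_iff] at h2
    have := hh w (by rw [abs_lt]; constructor <;> linarith [h2.2])
    refine ⟨w, h1, h2.1, ?_⟩
    simp only [eval_mul, eval_sub, eval_X, eval_C]
    exact mul_pos (by linarith) this

/-- The polynomial `q = p - p(a)` is positive just after `a`. If `q(b) ≤ 0`, it has a first root
after that point; `q` is negative just before this root, which forces a still earlier one. -/
theorem PolyIVT.eval_lt_eval_of_derivative_pos_Icc (hR : PolyIVT R) (p : R[X]) {a b : R}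
    (hab : a < b) (h : ∀ x, a ≤ x → x ≤ b → 0 < p.derivative.eval x) :
    p.eval a < p.eval b := by
  set q := p - C (p.eval a) with hq
  have hqd : q.derivative = p.derivative := by simp [hq]
  have hqe : ∀ x, q.eval x = p.eval x - p.eval a := fun x => by simp [hq]
  by_contra hlt
  have hqb : q.eval b ≤ 0 := by rw [hqe]; linarith
  obtain ⟨z, hz1, hz2, hz⟩ := (q.exists_eval_of_root_of_derivative_pos (r := a) (u := b)
    (by rw [hqe]; simp) (hqd ▸ h a le_rfl hab.le)).2 hab
  have hq0 : q ≠ 0 := fun h0 => by simp [h0] at hz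
  have hne : (q.roots.toFinset.filter fun c => z < c ∧ c ≤ b).Nonempty := by
    rcases hqb.lt_or_eq with hb | hb
    · obtain ⟨c, h1, h2, h3⟩ := hR.exists_root_of_pos_of_neg q hz2 hz hb
      exact ⟨c, by simp [hq0, h1, h2.le, h3]⟩
    · exact ⟨b, by simp [hq0, hz2, hb]⟩
  obtain ⟨r, hr, hmin⟩ := Finset.exists_min_image _ id hne
  simp only [Finset.mem_filter, Multiset.mem_toFinset, mem_roots hq0, IsRoot.def] at hr hmin
  obtain ⟨w, hw1, hw2, hw⟩ := (q.exists_eval_of_root_of_derivative_pos (r := r) (u := z) hr.1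
    (hqd ▸ h r (hz1.trans hr.2.1).le hr.2.2)).1 hr.2.1
  obtain ⟨c, h1, h2, h3⟩ := hR.exists_root_of_pos_of_neg q hw1 hz hw
  have := hmin c ⟨h3, h1, (h2.trans hw2).le.trans hr.2.2⟩
  exact absurd (h2.trans hw2) (not_lt.2 this)

/-- The endpoints, where the derivative may vanish, are reached by continuity. The intermediate
points `x < y` keep the final inequality strict. -/
theorem PolyIVT.eval_lt_eval_of_derivative_pos (hR : PolyIVT R) (p : R[X]) {a b : R}
    (hab : a < b) (h : ∀ x, a < x → x < b → 0 < p.derivative.eval x) :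
    p.eval a < p.eval b := by
  let : TopologicalSpace R := Preorder.topology R
  have : OrderTopology R := ⟨rfl⟩
  have hmono : ∀ x y, a < x → x < y → y < b → p.eval x < p.eval y := fun x y h1 h2 h3 =>
    hR.eval_lt_eval_of_derivative_pos_Icc p h2 fun z hz1 hz2 =>
      h z (h1.trans_le hz1) (hz2.trans_lt h3)
  obtain ⟨x, hax, hxb⟩ := exists_between hab
  obtain ⟨y, hxy, hyb⟩ := exists_between hxb
  have h1 : p.eval a ≤ p.eval x := by
    have : Set.Icc a x ⊆ {z | p.eval z ≤ p.eval x} := by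
      rw [← closure_Ioo hax.ne]
      exact closure_minimal (fun z hz => (hmono z x hz.1 hz.2 hxb).le)
        (isClosed_le p.continuous continuous_const)
    exact this ⟨le_rfl, hax.le⟩
  have h2 : p.eval y ≤ p.eval b := by
    have : Set.Icc y b ⊆ {z | p.eval y ≤ p.eval z} := by
      rw [← closure_Ioo hyb.ne]
      exact closure_minimal (fun z hz => (hmono y z (hax.trans hxy) hz.1 hz.2).le)
        (isClosed_le continuous_const p.continuous)
    exact this ⟨hyb.le, le_rfl⟩
  exact (h1.trans_lt (hmono x y hax hxy hyb)).trans_le h2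

end PolynomialOrder

/-! ### Order-preserving matchings of points in two ordered fields -/

section SameCut

open Polynomial

theorem lt_iff_lt_and_of_lt {α β : Type*} [Preorder α] [Preorder β] {a b : α} {c d : β}
    (h : a < b) (h' : c < d) : (a < b ↔ c < d) ∧ (b < a ↔ d < c) :=
  ⟨iff_of_true h h', iff_of_false h.not_gt h'.not_gt⟩

theorem lt_iff_lt_and_of_gt {α β : Type*} [Preorder α] [Preorder β] {a b : α} {c d : β}
    (h : b < a) (h' : d < c) : (a < b ↔ c < d) ∧ (b < a ↔ d < c) :=
  ⟨iff_of_false h.not_gt h'.not_gt, iff_of_true h h'⟩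

theorem Polynomial.natDegree_neg_comp_neg_X {R : Type*} [CommRing R] [IsDomain R] (p : R[X]) :
    (-p.comp (-X)).natDegree = p.natDegree := by
  rw [natDegree_neg, natDegree_comp]; simp

theorem Polynomial.leadingCoeff_neg_comp_neg_X {R : Type*} [CommRing R] [IsDomain R] (p : R[X]) :
    (-p.comp (-X)).leadingCoeff = -(p.leadingCoeff * (-1) ^ p.natDegree) := by
  rw [leadingCoeff_neg, leadingCoeff_comp (by simp)]; simp

variable {R₁ R₂ : Type*} [Field R₁] [LinearOrder R₁] [IsStrictOrderedRing R₁]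
  [Field R₂] [LinearOrder R₂] [IsStrictOrderedRing R₂]

/-- `x` and `y` lie in corresponding positions with respect to the pairs in `Z`. -/
def SameCut (Z : Finset (R₁ × R₂)) (x : R₁) (y : R₂) : Prop :=
  ∀ z ∈ Z, (z.1 < x ↔ z.2 < y) ∧ (x < z.1 ↔ y < z.2)

/-- `Z` is the graph of a strictly increasing partial function. -/
def IsMonoCorr (Z : Finset (R₁ × R₂)) : Prop :=
  ∀ z ∈ Z, SameCut Z z.1 z.2

/-- The pairs in corresponding positions split into products of a cell of `R₁` with a cell of `R₂`.
-/
theorem SameCut.rect {Z : Finset (R₁ × R₂)} {x x' : R₁} {y y' : R₂} (h : SameCut Z x y)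
    (h₁ : SameCut Z x' y) (h₂ : SameCut Z x y') : SameCut Z x' y' := fun z hz =>
  ⟨(h₁ z hz).1.trans ((h z hz).1.symm.trans (h₂ z hz).1),
    (h₁ z hz).2.trans ((h z hz).2.symm.trans (h₂ z hz).2)⟩

theorem SameCut.eq_iff {Z : Finset (R₁ × R₂)} {x : R₁} {y : R₂} (h : SameCut Z x y)
    {z : R₁ × R₂} (hz : z ∈ Z) : x = z.1 ↔ y = z.2 := by
  have h1 := h z hz
  rw [le_antisymm_iff, le_antisymm_iff, ← not_lt, ← not_lt, ← not_lt, ← not_lt, h1.1, h1.2]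

theorem sameCut_image_swap {Z : Finset (R₁ × R₂)} {x : R₁} {y : R₂} :
    SameCut (Z.image Prod.swap) y x ↔ SameCut Z x y := by
  simp only [SameCut, Finset.forall_mem_image, Prod.fst_swap, Prod.snd_swap]
  exact forall₂_congr fun z _ => and_congr Iff.comm Iff.comm

theorem IsMonoCorr.swap {Z : Finset (R₁ × R₂)} (h : IsMonoCorr Z) :
    IsMonoCorr (Z.image Prod.swap) := by
  simp only [IsMonoCorr, Finset.forall_mem_image, Prod.fst_swap, Prod.snd_swap, sameCut_image_swap]
  exact h

theorem sameCut_image_neg {Z : Finset (R₁ × R₂)} {x : R₁} {y : R₂} :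
    SameCut (Z.image fun z => (-z.1, -z.2)) x y ↔ SameCut Z (-x) (-y) := by
  simp only [SameCut, Finset.forall_mem_image]
  refine forall₂_congr fun z _ => ?_
  rw [neg_lt, neg_lt (a := z.2), lt_neg, lt_neg (a := y)]
  exact and_comm

theorem IsMonoCorr.neg {Z : Finset (R₁ × R₂)} (h : IsMonoCorr Z) :
    IsMonoCorr (Z.image fun z => (-z.1, -z.2)) := by
  simp only [IsMonoCorr, Finset.forall_mem_image, sameCut_image_neg, neg_neg]
  exact h

/-- If `x` is not matched, the partners of the points below it lie strictly below the partners of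
the points above it; a dense order without endpoints has an element in between. -/
theorem IsMonoCorr.exists_sameCut {Z : Finset (R₁ × R₂)} (h : IsMonoCorr Z) (x : R₁) :
    ∃ y, SameCut Z x y := by
  by_cases hx : ∃ z ∈ Z, z.1 = x
  · obtain ⟨z, hz, rfl⟩ := hx
    exact ⟨z.2, h z hz⟩
  · push Not at hx
    obtain ⟨y, h1, h2⟩ := Order.exists_between_finsets
      ((Z.filter fun z => z.1 < x).image Prod.snd) ((Z.filter fun z => x < z.1).image Prod.snd)
      (by
        simp only [Finset.forall_mem_image, Finset.mem_filter]
        rintro a ⟨ha, hax⟩ b ⟨hb, hbx⟩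
        exact (h b hb a ha).1.1 (hax.trans hbx))
    simp only [Finset.forall_mem_image, Finset.mem_filter] at h1 h2
    refine ⟨y, fun z hz => ?_⟩
    rcases lt_or_gt_of_ne (hx z hz) with hlt | hlt
    · have := h1 ⟨hz, hlt⟩
      exact lt_iff_lt_and_of_lt hlt this
    · have := h2 ⟨hz, hlt⟩
      exact lt_iff_lt_and_of_gt hlt this

/-- If `p₁` is nonnegative at `x` and increasing on the cell of `x`, then `p₂` becomes positive
somewhere to the right of the corresponding cell. -/
theorem exists_right_eval_pos {Z : Finset (R₁ × R₂)} (hZ : IsMonoCorr Z)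
    (h₁ : PolyIVT R₁) {p₁ : R₁[X]} {p₂ : R₂[X]}
    (hd₁ : 0 < p₁.natDegree) (hd₂ : 0 < p₂.natDegree)
    (hl : 0 < p₁.leadingCoeff → 0 < p₂.leadingCoeff)
    (hs : ∀ z ∈ Z, 0 < p₁.eval z.1 → 0 < p₂.eval z.2)
    {x : R₁} {y : R₂} (hxy : SameCut Z x y) (hx : ∀ z ∈ Z, z.1 ≠ x)
    (hder : ∀ t, SameCut Z t y → 0 < p₁.derivative.eval t) (h0 : 0 ≤ p₁.eval x) :
    ∃ w, y < w ∧ 0 < p₂.eval w ∧ ∀ t, y ≤ t → t < w → SameCut Z x t := by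
  -- If the cell is unbounded to the right, the sign far out is that of the leading coefficient.
  -- Otherwise its right end belongs to a pair of `Z`, where positivity carries over by `hs`.
  rcases (Z.filter fun z => x < z.1).eq_empty_or_nonempty with he | hne
  · rw [Finset.filter_eq_empty_iff] at he
    have hlow : ∀ z ∈ Z, z.1 < x := fun z hz => lt_of_le_of_ne (not_lt.1 (he hz)) (hx z hz)
    have hup₁ : ∀ t, x ≤ t → SameCut Z t y := fun t ht z hz => by
      have h1 := hlow z hz
      have h2 := ((hxy z hz).1.1 h1)
      exact lt_iff_lt_and_of_lt (h1.trans_le ht) h2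
    have hup₂ : ∀ t, y ≤ t → SameCut Z x t := fun t ht z hz => by
      have h1 := hlow z hz
      have h2 := ((hxy z hz).1.1 h1).trans_le ht
      exact lt_iff_lt_and_of_lt h1 h2
    have hlead : 0 < p₁.leadingCoeff := by
      by_contra hn
      have hlt : p₁.leadingCoeff < 0 := lt_of_le_of_ne (not_lt.1 hn)
        (leadingCoeff_ne_zero.2 (ne_zero_of_natDegree_gt hd₁))
      obtain ⟨B, hB⟩ := (-p₁).exists_forall_gt_lt_eval (by simpa using hd₁) (by simpa using hlt) 0
      obtain ⟨t, ht⟩ := exists_gt (max B x)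
      rw [max_lt_iff] at ht
      have h1 := hB t ht.1
      have h2 := h₁.eval_lt_eval_of_derivative_pos p₁ ht.2 fun s hs _ => hder s (hup₁ s hs.le)
      rw [eval_neg] at h1
      linarith
    obtain ⟨B, hB⟩ := p₂.exists_forall_gt_lt_eval hd₂ (hl hlead) 0
    obtain ⟨t, ht⟩ := exists_gt (max B y)
    rw [max_lt_iff] at ht
    exact ⟨t, ht.2, hB t ht.1, fun s hs _ => hup₂ s hs⟩
  · obtain ⟨z, hz, hmin⟩ := Finset.exists_min_image _ Prod.snd hne
    simp only [Finset.mem_filter] at hz hmin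
    refine ⟨z.2, (hxy z hz.1).2.1 hz.2, hs z hz.1 ?_, ?_⟩
    · refine h0.trans_lt (h₁.eval_lt_eval_of_derivative_pos p₁ hz.2 fun t ht1 ht2 => hder t ?_)
      intro w hw
      rcases lt_or_gt_of_ne (hx w hw) with hlt | hlt
      · have h2 := (hxy w hw).1.1 hlt
        have h3 := hlt.trans ht1
        exact lt_iff_lt_and_of_lt h3 h2
      · have h2 := (hxy w hw).2.1 hlt
        have h3 : t < w.1 := by
          have := hmin w ⟨hw, hlt⟩
          exact ht2.trans_le (not_lt.1 fun h => absurd ((hZ z hz.1 w hw).1.1 h) (not_lt.2 this))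
        exact lt_iff_lt_and_of_gt h3 h2
    · intro t ht1 ht2 w hw
      rcases lt_or_gt_of_ne (hx w hw) with hlt | hlt
      · have h2 := ((hxy w hw).1.1 hlt).trans_le ht1
        exact lt_iff_lt_and_of_lt hlt h2
      · have h2 := ht2.trans_le (hmin w ⟨hw, hlt⟩)
        exact lt_iff_lt_and_of_gt hlt h2

/-- Reflection of both lines: `p(X)` is replaced by `-p(-X)`, which is again increasing on the
reflected cell. The degrees must agree for the leading signs to change in the same way. -/
theorem exists_left_eval_neg {Z : Finset (R₁ × R₂)} (hZ : IsMonoCorr Z)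
    (h₁ : PolyIVT R₁) {p₁ : R₁[X]} {p₂ : R₂[X]}
    (hd₁ : 0 < p₁.natDegree) (hd : p₁.natDegree = p₂.natDegree)
    (hl : SignType.sign p₁.leadingCoeff = SignType.sign p₂.leadingCoeff)
    (hs : ∀ z ∈ Z, p₁.eval z.1 < 0 → p₂.eval z.2 < 0)
    {x : R₁} {y : R₂} (hxy : SameCut Z x y) (hx : ∀ z ∈ Z, z.1 ≠ x)
    (hder : ∀ t, SameCut Z t y → 0 < p₁.derivative.eval t) (h0 : p₁.eval x ≤ 0) :
    ∃ w, w < y ∧ p₂.eval w < 0 ∧ ∀ t, w < t → t ≤ y → SameCut Z x t := by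
  obtain ⟨w, hw1, hw2, hw3⟩ := exists_right_eval_pos hZ.neg h₁ (p₁ := -p₁.comp (-X))
    (p₂ := -p₂.comp (-X)) (by rwa [natDegree_neg_comp_neg_X])
    (by rwa [natDegree_neg_comp_neg_X, ← hd])
    (by
      rw [leadingCoeff_neg_comp_neg_X, leadingCoeff_neg_comp_neg_X, ← hd, ← sign_eq_one_iff, ← sign_eq_one_iff, Left.sign_neg, Left.sign_neg,
        sign_mul, sign_mul, hl]
      rcases p₁.natDegree.even_or_odd with h | h <;> simp [h.neg_one_pow])
    (by
      simp only [Finset.forall_mem_image]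
      simpa using hs) (x := -x) (y := -y)
    (by simpa [sameCut_image_neg] using hxy) (by
      simp only [Finset.forall_mem_image]
      simpa using hx)
    (by
      intro t ht
      rw [sameCut_image_neg, neg_neg] at ht
      simpa [derivative_comp] using hder _ ht)
    (by simpa using h0)
  refine ⟨-w, by linarith, by simpa using hw2, fun t ht1 ht2 => ?_⟩
  have := hw3 (-t) (by linarith) (by linarith)
  simpa [sameCut_image_neg] using this

end SameCut

/-! ### Adding the roots of one polynomial to a matching -/

section SignDetermination

open Polynomial

variable {R₁ R₂ : Type*} [Field R₁] [LinearOrder R₁] [IsStrictOrderedRing R₁]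
  [Field R₂] [LinearOrder R₂] [IsStrictOrderedRing R₂]

theorem SameCut.between {Z : Finset (R₁ × R₂)} {a b t : R₁} {y : R₂} (ha : SameCut Z a y)
    (hb : SameCut Z b y) (hat : a ≤ t) (htb : t ≤ b) : SameCut Z t y := fun z hz =>
  ⟨⟨fun h => (hb z hz).1.1 (h.trans_le htb), fun h => ((ha z hz).1.2 h).trans_le hat⟩,
    ⟨fun h => (ha z hz).2.1 (hat.trans_lt h), fun h => htb.trans_lt ((hb z hz).2.2 h)⟩⟩

theorem SameCut.exists_right {Z : Finset (R₁ × R₂)} {x : R₁} {y : R₂} (h : SameCut Z x y)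
    (hx : ∀ z ∈ Z, z.1 ≠ x) : ∃ u, x < u ∧ ∀ t, x ≤ t → t < u → SameCut Z t y := by
  obtain ⟨u, h1, h2⟩ := Order.exists_between_finsets {x}
    ((Z.filter fun z => x < z.1).image Prod.fst) (by simp)
  simp only [Finset.forall_mem_image, Finset.mem_filter, Finset.mem_singleton, forall_eq] at h1 h2
  refine ⟨u, h1, fun t ht1 ht2 z hz => ?_⟩
  rcases lt_or_gt_of_ne (hx z hz) with hlt | hlt
  · exact lt_iff_lt_and_of_lt (hlt.trans_le ht1) ((h z hz).1.1 hlt)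
  · exact lt_iff_lt_and_of_gt (ht2.trans (h2 ⟨hz, hlt⟩)) ((h z hz).2.1 hlt)

/-- The derivative has constant sign on an open cell; a zero there would make it vanish on an
interval, hence identically. -/
theorem SameCut.derivative_ne_zero {Z : Finset (R₁ × R₂)} {x : R₁} {y : R₂} (h : SameCut Z x y)
    (hx : ∀ z ∈ Z, z.1 ≠ x) {p₁ : R₁[X]} {p₂ : R₂[X]} (hd₁ : 0 < p₁.natDegree)
    (hder : ∀ x y, SameCut Z x y →
      SignType.sign (p₁.derivative.eval x) = SignType.sign (p₂.derivative.eval y)) :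
    p₁.derivative.eval x ≠ 0 := by
  intro h0
  obtain ⟨u, hu, hu'⟩ := h.exists_right hx
  have hz : ∀ t ∈ Set.Ioo x u, p₁.derivative.eval t = 0 := fun t ht => by
    rw [← sign_eq_zero_iff, hder t y (hu' t ht.1.le ht.2), ← hder x y h, h0, sign_zero]
  have : p₁.derivative = 0 := Polynomial.eq_zero_of_infinite_isRoot _
    ((Set.Ioo_infinite hu).mono hz)
  exact hd₁.ne' (derivative_eq_zero.1 this)

/-- A cell is either a single point of `Z` or an interval on which the polynomial is strictly
monotone. -/
theorem SameCut.root_unique {Z : Finset (R₁ × R₂)} (h₁ : PolyIVT R₁) {a b : R₁} {y : R₂}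
    (ha : SameCut Z a y) (hb : SameCut Z b y) {p₁ : R₁[X]} {p₂ : R₂[X]}
    (hd₁ : 0 < p₁.natDegree)
    (hder : ∀ x y, SameCut Z x y →
      SignType.sign (p₁.derivative.eval x) = SignType.sign (p₂.derivative.eval y))
    (hpa : p₁.eval a = 0) (hpb : p₁.eval b = 0) : a = b := by
  wlog hab : a < b generalizing a b
  · rcases (not_lt.1 hab).eq_or_lt with h | h
    · exact h.symm
    · exact (this hb ha hpb hpa h).symm
  exfalso
  by_cases hx : ∀ z ∈ Z, z.1 ≠ a
  · have hne := ha.derivative_ne_zero hx hd₁ hder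
    have hs : ∀ t, a ≤ t → t ≤ b →
        SignType.sign (p₁.derivative.eval t) = SignType.sign (p₁.derivative.eval a) :=
      fun t h1 h2 => by rw [hder t y (ha.between hb h1 h2), hder a y ha]
    rcases lt_or_gt_of_ne hne with hn | hn
    · have := h₁.eval_lt_eval_of_derivative_pos_Icc (-p₁) hab fun t h1 h2 => by
        have := hs t h1 h2
        rw [sign_neg hn, sign_eq_neg_one_iff] at this
        simpa using this
      simp [hpa, hpb] at this
    · have := h₁.eval_lt_eval_of_derivative_pos_Icc p₁ hab fun t h1 h2 => by
        have := hs t h1 h2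
        rwa [sign_pos hn, sign_eq_one_iff] at this
      simp [hpa, hpb] at this
  · push Not at hx
    obtain ⟨z, hz, hza⟩ := hx
    have := (hb.eq_iff hz).2 ((ha.eq_iff hz).1 hza.symm)
    exact hab.ne (hza.symm.trans this.symm)

/-- Since `p₁` increases from a value `≥ 0` at `x`, `p₂` becomes positive to the right of `y`, so it
has a root `r₂ ≥ y` in the cell. Symmetrically `p₁` has a root `r₁ ≤ x` in the cell. By `hroots`
these roots lie on the same side of `x` and `y`, so both inequalities are equalities. -/
theorem eval_eq_zero_of_increasing_cell {Z : Finset (R₁ × R₂)} (hZ : IsMonoCorr Z)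
    (h₁ : PolyIVT R₁) (h₂ : PolyIVT R₂) {p₁ : R₁[X]} {p₂ : R₂[X]}
    (hd₁ : 0 < p₁.natDegree) (hd : p₁.natDegree = p₂.natDegree)
    (hl : SignType.sign p₁.leadingCoeff = SignType.sign p₂.leadingCoeff)
    (hs : ∀ z ∈ Z, SignType.sign (p₁.eval z.1) = SignType.sign (p₂.eval z.2))
    {x : R₁} {y : R₂} (hxy : SameCut Z x y) (hx : ∀ z ∈ Z, z.1 ≠ x)
    (hder₁ : ∀ t, SameCut Z t y → 0 < p₁.derivative.eval t)
    (hder₂ : ∀ t, SameCut Z x t → 0 < p₂.derivative.eval t)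
    (hroots : ∀ r₁ r₂, p₁.eval r₁ = 0 → p₂.eval r₂ = 0 → SameCut Z r₁ r₂ →
      (r₁ < x ↔ r₂ < y) ∧ (x < r₁ ↔ y < r₂))
    (h0 : 0 ≤ p₁.eval x) (h0' : p₂.eval y ≤ 0) : p₁.eval x = 0 ∧ p₂.eval y = 0 := by
  obtain ⟨w₂, hw₂, hpw₂, hcut₂⟩ := exists_right_eval_pos hZ h₁ hd₁ (hd ▸ hd₁)
    (fun h => by rwa [← sign_eq_one_iff, ← hl, sign_eq_one_iff])
    (fun z hz h => by rwa [← sign_eq_one_iff, ← hs z hz, sign_eq_one_iff]) hxy hx hder₁ h0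
  obtain ⟨w₁, hw₁, hpw₁, hcut₁⟩ := exists_left_eval_neg hZ.swap h₂ (hd ▸ hd₁) hd.symm hl.symm
    (p₁ := p₂) (p₂ := p₁) (x := y) (y := x)
    (by
      simp only [Finset.forall_mem_image, Prod.fst_swap, Prod.snd_swap]
      exact fun z hz h => by rwa [← sign_eq_neg_one_iff, hs z hz, sign_eq_neg_one_iff])
    (sameCut_image_swap.2 hxy)
    (by
      simp only [Finset.forall_mem_image, Prod.fst_swap]
      exact fun z hz h => hx z hz ((hxy.eq_iff hz).2 h.symm).symm)
    (fun t ht => hder₂ t (sameCut_image_swap.1 ht)) h0'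
  simp only [sameCut_image_swap] at hcut₁
  obtain ⟨r₂, hr₂, hyr₂, hrw₂⟩ : ∃ r, p₂.eval r = 0 ∧ y ≤ r ∧ r < w₂ := by
    rcases h0'.lt_or_eq with h | h
    · obtain ⟨r, a, b, c⟩ := h₂ p₂ y w₂ hw₂ h hpw₂
      exact ⟨r, c, a.le, b⟩
    · exact ⟨y, h, le_rfl, hw₂⟩
  obtain ⟨r₁, hr₁, hxr₁, hrw₁⟩ : ∃ r, p₁.eval r = 0 ∧ r ≤ x ∧ w₁ < r := by
    rcases h0.lt_or_eq with h | h
    · obtain ⟨r, a, b, c⟩ := h₁ p₁ w₁ x hw₁ hpw₁ h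
      exact ⟨r, c, b.le, a⟩
    · exact ⟨x, h.symm, le_rfl, hw₁⟩
  have := hroots r₁ r₂ hr₁ hr₂ (hxy.rect (hcut₁ r₁ hrw₁ hxr₁) (hcut₂ r₂ hyr₂ hrw₂))
  have e₁ : r₁ = x := le_antisymm hxr₁ (not_lt.1 fun h => hyr₂.not_gt (this.1.1 h))
  have e₂ : r₂ = y := le_antisymm (not_lt.1 fun h => hxr₁.not_gt (this.2.2 h)) hyr₂
  exact ⟨e₁ ▸ hr₁, e₂ ▸ hr₂⟩

/-- Unequal signs put one value weakly above zero and the other weakly below, so the preceding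
lemma, used in both directions between the fields, makes both vanish. -/
theorem sign_eval_eq_of_increasing_cell {Z : Finset (R₁ × R₂)} (hZ : IsMonoCorr Z)
    (h₁ : PolyIVT R₁) (h₂ : PolyIVT R₂) {p₁ : R₁[X]} {p₂ : R₂[X]}
    (hd₁ : 0 < p₁.natDegree) (hd : p₁.natDegree = p₂.natDegree)
    (hl : SignType.sign p₁.leadingCoeff = SignType.sign p₂.leadingCoeff)
    (hs : ∀ z ∈ Z, SignType.sign (p₁.eval z.1) = SignType.sign (p₂.eval z.2))
    {x : R₁} {y : R₂} (hxy : SameCut Z x y) (hx : ∀ z ∈ Z, z.1 ≠ x)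
    (hder₁ : ∀ t, SameCut Z t y → 0 < p₁.derivative.eval t)
    (hder₂ : ∀ t, SameCut Z x t → 0 < p₂.derivative.eval t)
    (hroots : ∀ r₁ r₂, p₁.eval r₁ = 0 → p₂.eval r₂ = 0 → SameCut Z r₁ r₂ →
      (r₁ < x ↔ r₂ < y) ∧ (x < r₁ ↔ y < r₂)) :
    SignType.sign (p₁.eval x) = SignType.sign (p₂.eval y) := by
  have A := eval_eq_zero_of_increasing_cell hZ h₁ h₂ hd₁ hd hl hs hxy hx hder₁ hder₂ hroots
  have B := eval_eq_zero_of_increasing_cell hZ.swap h₂ h₁ (hd ▸ hd₁) hd.symm hl.symm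
    (p₁ := p₂) (p₂ := p₁) (x := y) (y := x)
    (by
      simp only [Finset.forall_mem_image, Prod.fst_swap, Prod.snd_swap]
      exact fun z hz => (hs z hz).symm)
    (sameCut_image_swap.2 hxy)
    (by
      simp only [Finset.forall_mem_image, Prod.fst_swap]
      exact fun z hz h => hx z hz ((hxy.eq_iff hz).2 h.symm).symm)
    (fun t ht => hder₂ t (sameCut_image_swap.1 ht))
    (fun t ht => hder₁ t (sameCut_image_swap.1 ht))
    (fun r₁ r₂ a b c => (hroots r₂ r₁ b a (sameCut_image_swap.1 c)).imp Iff.symm Iff.symm)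
  rcases lt_trichotomy (p₁.eval x) 0 with a | a | a <;>
    rcases lt_trichotomy (p₂.eval y) 0 with b | b | b
  · rw [sign_neg a, sign_neg b]
  · exact absurd (B b.ge a.le).2 a.ne
  · exact absurd (B b.le a.le).2 a.ne
  · exact absurd (A a.ge b.le).2 b.ne
  · rw [a, b, sign_zero, sign_zero]
  · exact absurd (B b.le a.le).1 b.ne'
  · exact absurd (A a.le b.le).1 a.ne'
  · exact absurd (A a.le b.le).1 a.ne'
  · rw [sign_pos a, sign_pos b]

/-- Refinement of a correspondence by the roots of a polynomial whose derivative and whose values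
at the given points have matching signs. -/
theorem exists_refinement {Z : Finset (R₁ × R₂)} (hZ : IsMonoCorr Z)
    (h₁ : PolyIVT R₁) (h₂ : PolyIVT R₂) {p₁ : R₁[X]} {p₂ : R₂[X]}
    (hd₁ : 0 < p₁.natDegree) (hd : p₁.natDegree = p₂.natDegree)
    (hl : SignType.sign p₁.leadingCoeff = SignType.sign p₂.leadingCoeff)
    (hs : ∀ z ∈ Z, SignType.sign (p₁.eval z.1) = SignType.sign (p₂.eval z.2))
    (hder : ∀ x y, SameCut Z x y →
      SignType.sign (p₁.derivative.eval x) = SignType.sign (p₂.derivative.eval y)) :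
    ∃ Z' : Finset (R₁ × R₂), Z ⊆ Z' ∧ IsMonoCorr Z' ∧
      (∀ z ∈ Z', z ∈ Z ∨ p₁.eval z.1 = 0 ∧ p₂.eval z.2 = 0) ∧
      ∀ x y, SameCut Z' x y → SignType.sign (p₁.eval x) = SignType.sign (p₂.eval y) := by
  classical
  have hp₁ : p₁ ≠ 0 := ne_zero_of_natDegree_gt hd₁
  have hp₂ : p₂ ≠ 0 := ne_zero_of_natDegree_gt (hd ▸ hd₁)
  -- A root of `p₁` is matched with a root of `p₂` when they lie in the same cell of `Z`; each cell
  -- holds at most one root of each.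
  set Z' := Z ∪ (p₁.roots.toFinset ×ˢ p₂.roots.toFinset).filter fun z => SameCut Z z.1 z.2
    with hZ'
  have hmem : ∀ z, z ∈ Z' ↔ z ∈ Z ∨ (p₁.eval z.1 = 0 ∧ p₂.eval z.2 = 0) ∧ SameCut Z z.1 z.2 :=
    fun z => by simp [hZ', hp₁, hp₂]
  have hsub : Z ⊆ Z' := Finset.subset_union_left
  refine ⟨Z', hsub, ?_, fun z hz => ((hmem z).1 hz).imp_right And.left, ?_⟩
  · intro z hz w hw
    rw [hmem] at hz hw
    rcases hw with hw | ⟨⟨hw₁, hw₂⟩, hwc⟩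
    · rcases hz with hz | ⟨_, hzc⟩
      · exact hZ z hz w hw
      · exact hzc w hw
    · rcases hz with hz | ⟨⟨hz₁, hz₂⟩, hzc⟩
      · exact (hwc z hz).symm
      -- Two new pairs in the same cell coincide; otherwise some pair `u` of `Z` separates them and
      -- fixes their order in both fields.
      · by_cases hc : SameCut Z w.1 z.2
        · have e₁ := hzc.root_unique h₁ hc hd₁ hder hz₁ hw₁
          have e₂ := (sameCut_image_swap.2 hzc).root_unique h₂
            (sameCut_image_swap.2 (hc.rect hzc hwc)) (p₁ := p₂) (p₂ := p₁) (hd ▸ hd₁)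
            (fun x y h => (hder y x (sameCut_image_swap.1 h)).symm) hz₂ hw₂
          simp [e₁, e₂]
        · simp only [SameCut, not_forall] at hc
          obtain ⟨u, hu, hc⟩ := hc
          have a := hzc u hu
          have b := hwc u hu
          rcases lt_or_ge w.1 z.1 with hlt | hge
          · refine lt_iff_lt_and_of_lt hlt (lt_of_not_ge fun hle => hc ⟨?_, ?_⟩)
            · exact ⟨fun h => a.1.1 (h.trans hlt), fun h => b.1.2 (h.trans_le hle)⟩
            · exact ⟨fun h => lt_of_not_ge fun h' => (b.2.1 h).not_ge (h'.trans hle),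
                fun h => hlt.trans (a.2.2 h)⟩
          · rcases hge.eq_or_lt with heq | hlt
            · exact absurd ⟨heq ▸ a.1, heq ▸ a.2⟩ hc
            · refine lt_iff_lt_and_of_gt hlt (lt_of_not_ge fun hle => hc ⟨?_, ?_⟩)
              · exact ⟨fun h => (b.1.1 h).trans_le hle, fun h => (a.1.2 h).trans hlt⟩
              · exact ⟨fun h => a.2.1 (hlt.trans h), fun h => b.2.2 (hle.trans_lt h)⟩
  · intro x y hxy'
    have hxy : SameCut Z x y := fun z hz => hxy' z (hsub hz)
    by_cases hx : ∀ z ∈ Z, z.1 ≠ x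
    · have hroots : ∀ r₁ r₂, p₁.eval r₁ = 0 → p₂.eval r₂ = 0 → SameCut Z r₁ r₂ →
          (r₁ < x ↔ r₂ < y) ∧ (x < r₁ ↔ y < r₂) := fun r₁ r₂ a b c =>
        hxy' (r₁, r₂) ((hmem _).2 (Or.inr ⟨⟨a, b⟩, c⟩))
      have hs₁ : ∀ t, SameCut Z t y →
          SignType.sign (p₁.derivative.eval t) = SignType.sign (p₁.derivative.eval x) :=
        fun t ht => by rw [hder t y ht, hder x y hxy]
      have hs₂ : ∀ t, SameCut Z x t →
          SignType.sign (p₂.derivative.eval t) = SignType.sign (p₁.derivative.eval x) :=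
        fun t ht => by rw [hder x t ht]
      rcases lt_or_gt_of_ne (hxy.derivative_ne_zero hx hd₁ hder) with hn | hn
      · have := sign_eval_eq_of_increasing_cell hZ h₁ h₂ (p₁ := -p₁) (p₂ := -p₂)
          (by simpa using hd₁) (by simpa using hd)
          (by simp only [leadingCoeff_neg, Left.sign_neg, hl])
          (fun z hz => by simp only [eval_neg, Left.sign_neg, hs z hz]) hxy hx
          (fun t ht => by
            have := hs₁ t ht
            rw [sign_neg hn, sign_eq_neg_one_iff] at this
            simpa using this)
          (fun t ht => by
            have := hs₂ t ht
            rw [sign_neg hn, sign_eq_neg_one_iff] at this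
            simpa using this)
          (by simpa using hroots)
        simpa only [eval_neg, Left.sign_neg, neg_inj] using this
      · exact sign_eval_eq_of_increasing_cell hZ h₁ h₂ hd₁ hd hl hs hxy hx
          (fun t ht => by
            have := hs₁ t ht
            rwa [sign_pos hn, sign_eq_one_iff] at this)
          (fun t ht => by
            have := hs₂ t ht
            rwa [sign_pos hn, sign_eq_one_iff] at this) hroots
    · push Not at hx
      obtain ⟨z, hz, rfl⟩ := hx
      rw [(hxy.eq_iff hz).1 rfl]
      exact hs z hz

end SignDetermination

/-! ### Elimination of one variable -/

section Elimination

open Polynomial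

variable {A : Type*} [CommRing A]

/-- Each division step multiplies by the square of the leading coefficient of `q`; the even exponent
makes the total factor positive wherever that coefficient does not vanish. -/
theorem Polynomial.exists_pseudo_remainder (p q : A[X]) (hq : 0 < q.natDegree) :
    ∃ r c : A[X], ∃ e : ℕ, C (q.leadingCoeff ^ (2 * e)) * p = c * q + r ∧
      r.natDegree < q.natDegree := by
  induction hn : p.natDegree using Nat.strong_induction_on generalizing p with
  | _ n ih =>
    rcases lt_or_ge p.natDegree q.natDegree with hlt | hge
    · exact ⟨p, 0, 0, by simp, hlt⟩
    · set d := C (q.leadingCoeff * p.leadingCoeff) * X ^ (p.natDegree - q.natDegree) with hd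
      set p' := C (q.leadingCoeff ^ 2) * p - d * q with hp'
      have hle : p'.natDegree ≤ p.natDegree := by
        refine (natDegree_sub_le _ _).trans (max_le (natDegree_C_mul_le _ _) ?_)
        refine natDegree_mul_le.trans ?_
        have : d.natDegree ≤ _ := natDegree_C_mul_X_pow_le (q.leadingCoeff * p.leadingCoeff)
          (p.natDegree - q.natDegree)
        omega
      have hcoeff : p'.coeff p.natDegree = 0 := by
        rw [hp', hd, coeff_sub, coeff_C_mul, mul_assoc, coeff_C_mul, coeff_X_pow_mul',
          if_pos (Nat.sub_le _ _), Nat.sub_sub_self hge, coeff_natDegree, coeff_natDegree]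
        ring
      have hlt : p'.natDegree < n := by
        refine hn ▸ lt_of_le_of_ne hle fun h => ?_
        rw [← h, coeff_natDegree, leadingCoeff_eq_zero] at hcoeff
        rw [hcoeff, natDegree_zero] at h
        omega
      obtain ⟨r, c, e, h1, h2⟩ := ih _ hlt p' rfl
      refine ⟨r, c + C (q.leadingCoeff ^ (2 * e)) * d, e + 1, ?_, h2⟩
      have : C (q.leadingCoeff ^ (2 * (e + 1))) * p =
          C (q.leadingCoeff ^ (2 * e)) * (p' + d * q) := by
        rw [hp', sub_add_cancel, ← mul_assoc, ← C_mul, ← pow_add]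
        rfl
      rw [this, mul_add, h1]
      ring

/-- `S` contains the derivatives, tails and pseudo-remainders of its nonconstant elements of
degree at least `d`. -/
def IsRemainderClosed (d : ℕ) (S : Finset A[X]) : Prop :=
  ∀ p ∈ S, d ≤ p.natDegree → 0 < p.natDegree → derivative p ∈ S ∧ p.eraseLead ∈ S ∧
    ∀ q ∈ S, d ≤ q.natDegree → 0 < q.natDegree → q.natDegree ≤ p.natDegree →
      ∃ r ∈ S, ∃ c : A[X], ∃ e : ℕ, C (q.leadingCoeff ^ (2 * e)) * p = c * q + r ∧
        r.natDegree < q.natDegree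

/-- Descending induction on the degree: the derivatives and tails of elements of degree `d`, and the
remainders modulo them, all have degree below `d`, so closure at degree `d` and above is not
disturbed. -/
theorem exists_isRemainderClosed_of_level (d : ℕ) (S : Finset A[X]) (hS : IsRemainderClosed d S) :
    ∃ S', S ⊆ S' ∧ IsRemainderClosed 0 S' := by
  classical
  induction d generalizing S with
  | zero => exact ⟨S, subset_rfl, hS⟩
  | succ d ih =>
    choose! r c e h1 h2 using fun (p q : A[X]) (h : 0 < q.natDegree) =>
      p.exists_pseudo_remainder q h
    set U := S.filter fun p => p.natDegree = d ∧ 0 < p.natDegree with hU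
    set S₂ := S ∪ (U.image derivative ∪ U.image eraseLead ∪
      (S ×ˢ U).image fun z => r z.1 z.2) with hS₂
    have hsub : S ⊆ S₂ := Finset.subset_union_left
    have hlow : ∀ p ∈ S₂, d ≤ p.natDegree → p ∈ S := by
      intro p hp hdeg
      simp only [hS₂, hU, Finset.mem_union, Finset.mem_image, Finset.mem_filter,
        Finset.mem_product, Prod.exists] at hp
      rcases hp with hp | (⟨q, ⟨-, hq, hq0⟩, rfl⟩ | ⟨q, ⟨-, hq, hq0⟩, rfl⟩) |
        ⟨p', q, ⟨-, -, hq, hq0⟩, rfl⟩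
      · exact hp
      · have := natDegree_derivative_lt hq0.ne'
        omega
      · have := q.eraseLead_natDegree_le
        omega
      · have := h2 p' q hq0
        omega
    suffices h : IsRemainderClosed d S₂ by
      obtain ⟨S', hS', hcl⟩ := ih S₂ h
      exact ⟨S', hsub.trans hS', hcl⟩
    intro p hp hdp hp0
    have hpS := hlow p hp hdp
    have hder : derivative p ∈ S₂ ∧ p.eraseLead ∈ S₂ := by
      rcases hdp.eq_or_lt with h | h
      · have hpU : p ∈ U := Finset.mem_filter.2 ⟨hpS, h.symm, hp0⟩
        simp only [hS₂, Finset.mem_union]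
        exact ⟨Or.inr (Or.inl (Or.inl (Finset.mem_image_of_mem _ hpU))),
          Or.inr (Or.inl (Or.inr (Finset.mem_image_of_mem _ hpU)))⟩
      · have := hS p hpS h hp0
        exact ⟨hsub this.1, hsub this.2.1⟩
    refine ⟨hder.1, hder.2, fun q hq hdq hq0 hqp => ?_⟩
    have hqS := hlow q hq hdq
    rcases hdq.eq_or_lt with h | h
    · have hqU : q ∈ U := Finset.mem_filter.2 ⟨hqS, h.symm, hq0⟩
      refine ⟨r p q, ?_, c p q, e p q, h1 p q hq0, h2 p q hq0⟩
      simp only [hS₂, Finset.mem_union]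
      exact Or.inr (Or.inr (Finset.mem_image.2 ⟨(p, q), Finset.mem_product.2 ⟨hpS, hqU⟩, rfl⟩))
    · obtain ⟨s, hs, hs'⟩ := (hS p hpS (h.trans_le hqp) hp0).2.2 q hqS h hq0 hqp
      exact ⟨s, hsub hs, hs'⟩

theorem exists_isRemainderClosed (S : Finset A[X]) :
    ∃ S', S ⊆ S' ∧ IsRemainderClosed 0 S' := by
  refine exists_isRemainderClosed_of_level (S.sup natDegree + 1) S fun p hp hd _ => ?_
  have := Finset.le_sup (f := natDegree) hp
  omega

/-- All that closure asks for has degree below the maximum, so an element of maximal degree is never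
among it. -/
theorem IsRemainderClosed.erase [DecidableEq A[X]] {S : Finset A[X]} (hS : IsRemainderClosed 0 S)
    {p : A[X]} (hp : ∀ q ∈ S, q.natDegree ≤ p.natDegree) : IsRemainderClosed 0 (S.erase p) := by
  have key : ∀ q ∈ S, q.natDegree < p.natDegree → q ∈ S.erase p := fun q hq hlt =>
    Finset.mem_erase.2 ⟨fun h => hlt.ne (h ▸ rfl), hq⟩
  intro q hq _ hq0
  have hq' := Finset.mem_of_mem_erase hq
  have hqp := hp q hq'
  obtain ⟨h1, h2, h3⟩ := hS q hq' (Nat.zero_le _) hq0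
  refine ⟨key _ h1 ((natDegree_derivative_lt hq0.ne').trans_le hqp), key _ h2 ?_, ?_⟩
  · have := q.eraseLead_natDegree_le
    omega
  · intro s hs _ hs0 hsq
    obtain ⟨r, hr, c, e, h4, h5⟩ := h3 s (Finset.mem_of_mem_erase hs) (Nat.zero_le _) hs0 hsq
    exact ⟨r, key r hr (by omega), c, e, h4, h5⟩

theorem Polynomial.map_eq_map_eraseLead {B : Type*} [CommRing B] (f : A →+* B) {p : A[X]}
    (h : f p.leadingCoeff = 0) : p.map f = p.eraseLead.map f := by
  conv_lhs => rw [← p.eraseLead_add_C_mul_X_pow, Polynomial.map_add, Polynomial.map_mul, map_C, h]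
  simp

variable {R₁ R₂ : Type*} [Field R₁] [LinearOrder R₁] [IsStrictOrderedRing R₁]
  [Field R₂] [LinearOrder R₂] [IsStrictOrderedRing R₂]

theorem sign_eval_map_eq_of_remainder {R : Type*} [Field R] [LinearOrder R]
    [IsStrictOrderedRing R] (f : A →+* R) {p q r c : A[X]} {e : ℕ}
    (h : C (q.leadingCoeff ^ (2 * e)) * p = c * q + r) (hq : f q.leadingCoeff ≠ 0) {x : R}
    (hx : (q.map f).eval x = 0) :
    SignType.sign ((p.map f).eval x) = SignType.sign ((r.map f).eval x) := by
  have h' := congrArg (fun s => (s.map f).eval x) h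
  simp only [Polynomial.map_mul, Polynomial.map_add, eval_mul, eval_add, hx, mul_zero, zero_add,
    map_C, eval_C] at h'
  rw [map_pow] at h'
  rw [← h', sign_mul, sign_pos ((even_two_mul e).pow_pos hq), one_mul]

/-- Induction on the set, removing an element `p` of maximal degree. If its leading coefficient maps
to zero, `p` may be replaced by its tail. Otherwise every matched point is a root of some `q` whose
leading coefficient survives, so the sign of `p` there is that of a pseudo-remainder, already
controlled; so is the derivative, and `exists_refinement` applies. The condition on roots in the
conclusion is the invariant that makes this work. -/
theorem exists_corr_of_isRemainderClosed (h₁ : PolyIVT R₁) (h₂ : PolyIVT R₂)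
    (f₁ : A →+* R₁) (f₂ : A →+* R₂) (S : Finset A[X]) (hS : IsRemainderClosed 0 S)
    (hf : ∀ p ∈ S, SignType.sign (f₁ p.leadingCoeff) = SignType.sign (f₂ p.leadingCoeff)) :
    ∃ Z : Finset (R₁ × R₂), IsMonoCorr Z ∧
      (∀ z ∈ Z, ∃ q ∈ S, 0 < q.natDegree ∧ f₁ q.leadingCoeff ≠ 0 ∧
        (q.map f₁).eval z.1 = 0 ∧ (q.map f₂).eval z.2 = 0) ∧
      ∀ p ∈ S, ∀ x y, SameCut Z x y →
        SignType.sign ((p.map f₁).eval x) = SignType.sign ((p.map f₂).eval y) := by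
  classical
  induction hn : S.card generalizing S with
  | zero =>
    rw [Finset.card_eq_zero] at hn
    subst hn
    exact ⟨∅, by simp [IsMonoCorr], by simp, by simp⟩
  | succ n ih =>
    obtain ⟨p, hp, hmax⟩ := S.exists_max_image natDegree (Finset.card_pos.1 (by omega))
    have hsub : S.erase p ⊆ S := Finset.erase_subset _ _
    obtain ⟨Z, hZ, hroot, hsign⟩ := ih (S.erase p) (hS.erase hmax) (fun q hq => hf q (hsub hq))
      (by rw [Finset.card_erase_of_mem hp, hn]; rfl)
    have key : ∀ q ∈ S, q.natDegree < p.natDegree → q ∈ S.erase p := fun q hq hlt =>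
      Finset.mem_erase.2 ⟨fun h => hlt.ne (h ▸ rfl), hq⟩
    have extend : (∀ x y, SameCut Z x y →
        SignType.sign ((p.map f₁).eval x) = SignType.sign ((p.map f₂).eval y)) →
        ∀ q ∈ S, ∀ x y, SameCut Z x y →
          SignType.sign ((q.map f₁).eval x) = SignType.sign ((q.map f₂).eval y) := by
      intro h q hq
      by_cases hqp : q = p
      · exact hqp ▸ h
      · exact hsign q (Finset.mem_erase.2 ⟨hqp, hq⟩)
    have hroot' : ∀ z ∈ Z, ∃ q ∈ S, 0 < q.natDegree ∧ f₁ q.leadingCoeff ≠ 0 ∧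
        (q.map f₁).eval z.1 = 0 ∧ (q.map f₂).eval z.2 = 0 := fun z hz =>
      let ⟨q, hq, h⟩ := hroot z hz
      ⟨q, hsub hq, h⟩
    rcases Nat.eq_zero_or_pos p.natDegree with h0 | h0
    · refine ⟨Z, hZ, hroot', extend fun x y _ => ?_⟩
      have hlc := hf p hp
      rw [leadingCoeff, h0] at hlc
      rw [eq_C_of_natDegree_eq_zero h0, map_C, map_C, eval_C, eval_C, hlc]
    · obtain ⟨hder, herase, hrem⟩ := hS p hp (Nat.zero_le _) h0
      by_cases hlc : f₁ p.leadingCoeff = 0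
      · have hlc₂ : f₂ p.leadingCoeff = 0 := by
          rw [← sign_eq_zero_iff, ← hf p hp, hlc, sign_zero]
        refine ⟨Z, hZ, hroot', extend ?_⟩
        rw [map_eq_map_eraseLead f₁ hlc, map_eq_map_eraseLead f₂ hlc₂]
        refine hsign _ (key _ herase ?_)
        have := p.eraseLead_natDegree_le
        omega
      · have hlc₂ : f₂ p.leadingCoeff ≠ 0 := by
          rw [← sign_ne_zero, ← hf p hp, sign_ne_zero]
          exact hlc
        have hd₁ := natDegree_map_of_leadingCoeff_ne_zero f₁ hlc
        have hd₂ := natDegree_map_of_leadingCoeff_ne_zero f₂ hlc₂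
        obtain ⟨Z', hZZ', hZ', hmem, hsign'⟩ := exists_refinement hZ h₁ h₂
          (p₁ := p.map f₁) (p₂ := p.map f₂) (by rwa [hd₁]) (by rw [hd₁, hd₂])
          (by rw [leadingCoeff_map_of_leadingCoeff_ne_zero f₁ hlc,
            leadingCoeff_map_of_leadingCoeff_ne_zero f₂ hlc₂, hf p hp])
          (by
            intro z hz
            obtain ⟨q, hq, hq0, hql, hq₁, hq₂⟩ := hroot z hz
            have hqS := hsub hq
            have hql₂ : f₂ q.leadingCoeff ≠ 0 := by
              rw [← sign_ne_zero, ← hf q hqS, sign_ne_zero]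
              exact hql
            obtain ⟨r, hr, c, e, hrc, hrq⟩ := hrem q hqS (Nat.zero_le _) hq0 (hmax q hqS)
            rw [sign_eval_map_eq_of_remainder f₁ hrc hql hq₁,
              sign_eval_map_eq_of_remainder f₂ hrc hql₂ hq₂]
            exact hsign r (key r hr (hrq.trans_le (hmax q hqS))) _ _ (hZ z hz))
          (by
            rw [derivative_map, derivative_map]
            exact hsign _ (key _ hder (natDegree_derivative_lt h0.ne')))
        refine ⟨Z', hZ', fun z hz => ?_, fun q hq x y hxy => ?_⟩
        · rcases hmem z hz with h | h
          · exact hroot' z h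
          · exact ⟨p, hp, h0, hlc, h⟩
        · by_cases hqp : q = p
          · exact hqp ▸ hsign' x y hxy
          · exact hsign q (Finset.mem_erase.2 ⟨hqp, hq⟩) x y fun z hz => hxy z (hZZ' hz)

/-- One-variable elimination: the sign vectors that the polynomials in `S` realize depend only on
the signs of finitely many elements of the coefficient ring. -/
theorem exists_finset_sign_transfer (h₁ : PolyIVT R₁) (h₂ : PolyIVT R₂) (S : Finset A[X]) :
    ∃ T : Finset A, ∀ (f₁ : A →+* R₁) (f₂ : A →+* R₂),
      (∀ t ∈ T, SignType.sign (f₁ t) = SignType.sign (f₂ t)) → ∀ x, ∃ y, ∀ p ∈ S,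
        SignType.sign ((p.map f₁).eval x) = SignType.sign ((p.map f₂).eval y) := by
  classical
  obtain ⟨S', hSS', hS'⟩ := exists_isRemainderClosed S
  refine ⟨S'.image leadingCoeff, fun f₁ f₂ hf x => ?_⟩
  rw [Finset.forall_mem_image] at hf
  obtain ⟨Z, hZ, -, hsign⟩ := exists_corr_of_isRemainderClosed h₁ h₂ f₁ f₂ S' hS' hf
  obtain ⟨y, hy⟩ := hZ.exists_sameCut x
  exact ⟨y, fun p hp => hsign p (hSS' hp) x y hy⟩

end Elimination

/-! ### Sign conditions in several variables and elimination of quantifiers -/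

section Semialgebraic

open MvPolynomial

/-- The polynomials in `T` have the same signs at `a` and `b`. -/
def SameSigns {α R₁ R₂ : Type*} [CommRing R₁] [LinearOrder R₁] [CommRing R₂] [LinearOrder R₂]
    (T : Finset (MvPolynomial α ℤ)) (a : α → R₁) (b : α → R₂) : Prop :=
  ∀ t ∈ T, SignType.sign (aeval a t) = SignType.sign (aeval b t)

theorem MvPolynomial.eval_map_optionEquivLeft {α R : Type*} [CommRing R] (a : α → R) (x : R)
    (t : MvPolynomial (Option α) ℤ) :
    ((optionEquivLeft ℤ α t).map (aeval a : MvPolynomial α ℤ →ₐ[ℤ] R).toRingHom).eval x =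
      aeval (fun o => o.elim x a) t := by
  induction t using MvPolynomial.induction_on with
  | C r => simp
  | add p q hp hq => simp only [map_add, Polynomial.map_add, Polynomial.eval_add, hp, hq]
  | mul_X p i hp =>
    rw [map_mul, Polynomial.map_mul, Polynomial.eval_mul, hp, map_mul]
    cases i <;> simp

section TwoFields

variable {R₁ R₂ : Type*} [Field R₁] [LinearOrder R₁] [IsStrictOrderedRing R₁]
  [Field R₂] [LinearOrder R₂] [IsStrictOrderedRing R₂]

theorem SameSigns.of_image_rename {α β : Type*} [DecidableEq (MvPolynomial β ℤ)]
    {T : Finset (MvPolynomial α ℤ)} {f : α → β}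
    {a : β → R₁} {b : β → R₂} (h : SameSigns (T.image (rename f)) a b) :
    SameSigns T (fun i => a (f i)) (fun i => b (f i)) := fun t ht => by
  have := h _ (Finset.mem_image_of_mem _ ht)
  rwa [aeval_rename, aeval_rename] at this

/-- The variable `none` is eliminated: polynomials are read as univariate over `MvPolynomial α ℤ`,
and the points `a₁`, `a₂` supply the two coefficient homomorphisms. -/
theorem exists_sameSigns_option (h₁ : PolyIVT R₁) (h₂ : PolyIVT R₂) {α : Type*}
    (T : Finset (MvPolynomial (Option α) ℤ)) : ∃ T' : Finset (MvPolynomial α ℤ),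
      ∀ (a₁ : α → R₁) (a₂ : α → R₂), SameSigns T' a₁ a₂ → ∀ x, ∃ y,
        SameSigns T (fun o => o.elim x a₁) (fun o => o.elim y a₂) := by
  classical
  obtain ⟨T', hT'⟩ := exists_finset_sign_transfer h₁ h₂ (T.image (optionEquivLeft ℤ α))
  refine ⟨T', fun a₁ a₂ h x => ?_⟩
  obtain ⟨y, hy⟩ := hT' (aeval a₁ : MvPolynomial α ℤ →ₐ[ℤ] R₁).toRingHom
    (aeval a₂ : MvPolynomial α ℤ →ₐ[ℤ] R₂).toRingHom h x
  refine ⟨y, fun t ht => ?_⟩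
  have := hy _ (Finset.mem_image_of_mem _ ht)
  rwa [eval_map_optionEquivLeft, eval_map_optionEquivLeft] at this

/-- Block elimination for sign conditions. -/
theorem exists_sameSigns_sum (h₁ : PolyIVT R₁) (h₂ : PolyIVT R₂) {α : Type*} (β : Type*) [Finite β]
    (T : Finset (MvPolynomial (α ⊕ β) ℤ)) : ∃ T' : Finset (MvPolynomial α ℤ),
      ∀ (a₁ : α → R₁) (a₂ : α → R₂), SameSigns T' a₁ a₂ → ∀ b₁ : β → R₁, ∃ b₂ : β → R₂,
        SameSigns T (Sum.elim a₁ b₁) (Sum.elim a₂ b₂) := by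
  classical
  induction β using Finite.induction_empty_option with
  | @of_equiv β β' e ih =>
    obtain ⟨T', hT'⟩ := ih (T.image (rename (Sum.map id e.symm)))
    refine ⟨T', fun a₁ a₂ h b₁ => ?_⟩
    obtain ⟨b₂, hb₂⟩ := hT' a₁ a₂ h (b₁ ∘ e)
    refine ⟨b₂ ∘ e.symm, ?_⟩
    convert hb₂.of_image_rename using 1 <;> ext (i | i) <;> simp
  | h_empty =>
    refine ⟨T.image (rename (Sum.elim id PEmpty.elim)), fun a₁ a₂ h b₁ => ⟨PEmpty.elim, ?_⟩⟩
    convert h.of_image_rename using 1 <;> ext (i | i) <;> first | rfl | exact i.elim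
  | @h_option β _ ih =>
    -- Reassociates the variables: the new one is eliminated alone, and the induction hypothesis
    -- handles the others.
    let f : α ⊕ Option β → Option (α ⊕ β) :=
      Sum.elim (fun i => some (Sum.inl i)) (fun o => o.map Sum.inr)
    obtain ⟨T₁, hT₁⟩ := exists_sameSigns_option h₁ h₂ (T.image (rename f))
    obtain ⟨T', hT'⟩ := ih T₁
    refine ⟨T', fun a₁ a₂ h b₁ => ?_⟩
    obtain ⟨b₂, hb₂⟩ := hT' a₁ a₂ h (fun i => b₁ (some i))
    obtain ⟨y, hy⟩ := hT₁ _ _ hb₂ (b₁ none)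
    refine ⟨fun o => o.elim y b₂, ?_⟩
    convert hy.of_image_rename using 1 <;> ext (i | _ | i) <;> rfl

end TwoFields

variable {R : Type*} [Field R] [LinearOrder R]

/-- Predicates defined by sign conditions on polynomials with integer coefficients. -/
def IsSemialg {α : Type*} (Q : (α → R) → Prop) : Prop :=
  ∃ T : Finset (MvPolynomial α ℤ), ∀ a b : α → R, SameSigns T a b → (Q a ↔ Q b)

/-- Functions given by polynomials with integer coefficients. -/
def IsPolyFun {α : Type*} (f : (α → R) → R) : Prop :=
  ∃ t : MvPolynomial α ℤ, ∀ a, f a = aeval a t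

section PolyFun

variable {α β : Type*} {f g : (α → R) → R}

theorem IsPolyFun.add (hf : IsPolyFun f) (hg : IsPolyFun g) : IsPolyFun fun a => f a + g a := by
  obtain ⟨s, hs⟩ := hf
  obtain ⟨t, ht⟩ := hg
  exact ⟨s + t, fun a => by simp only [map_add, hs, ht]⟩

theorem IsPolyFun.mul (hf : IsPolyFun f) (hg : IsPolyFun g) : IsPolyFun fun a => f a * g a := by
  obtain ⟨s, hs⟩ := hf
  obtain ⟨t, ht⟩ := hg
  exact ⟨s * t, fun a => by simp only [map_mul, hs, ht]⟩

theorem IsPolyFun.sub (hf : IsPolyFun f) (hg : IsPolyFun g) : IsPolyFun fun a => f a - g a := by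
  obtain ⟨s, hs⟩ := hf
  obtain ⟨t, ht⟩ := hg
  exact ⟨s - t, fun a => by simp only [map_sub, hs, ht]⟩

theorem isPolyFun_zero : IsPolyFun fun _ : α → R => 0 := ⟨0, fun a => by simp⟩

theorem isPolyFun_one : IsPolyFun fun _ : α → R => 1 := ⟨1, fun a => by simp⟩

theorem isPolyFun_apply (i : α) : IsPolyFun fun a : α → R => a i := ⟨X i, fun a => by simp⟩

theorem isPolyFun_sum {ι : Type*} {s : Finset ι} {f : ι → (α → R) → R}
    (hf : ∀ i, IsPolyFun (f i)) : IsPolyFun fun a => ∑ i ∈ s, f i a := by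
  choose t ht using hf
  exact ⟨∑ i ∈ s, t i, fun a => by rw [map_sum]; exact Finset.sum_congr rfl fun i _ => ht i a⟩

theorem IsPolyFun.comp_inl (hf : IsPolyFun f) :
    IsPolyFun fun a : α ⊕ β → R => f fun i => a (Sum.inl i) := by
  obtain ⟨t, ht⟩ := hf
  exact ⟨rename Sum.inl t, fun a => by simp only [ht, aeval_rename]; rfl⟩

end PolyFun

variable {α β : Type*} {Q Q' : (α → R) → Prop}

theorem IsPolyFun.pos {f : (α → R) → R} (hf : IsPolyFun f) : IsSemialg fun a => 0 < f a := by
  obtain ⟨t, ht⟩ := hf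
  refine ⟨{t}, fun a b h => ?_⟩
  have := h t (Finset.mem_singleton_self t)
  simp only [ht]
  rw [← sign_eq_one_iff, this, sign_eq_one_iff]

theorem IsSemialg.not (h : IsSemialg Q) : IsSemialg fun a => ¬ Q a :=
  let ⟨T, hT⟩ := h
  ⟨T, fun a b hab => not_congr (hT a b hab)⟩

theorem isSemialg_const (p : Prop) : IsSemialg fun _ : α → R => p :=
  ⟨∅, fun _ _ _ => Iff.rfl⟩

theorem IsSemialg.and (h : IsSemialg Q) (h' : IsSemialg Q') : IsSemialg fun a => Q a ∧ Q' a := by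
  classical
  obtain ⟨T, hT⟩ := h
  obtain ⟨T', hT'⟩ := h'
  exact ⟨T ∪ T', fun a b hab => and_congr
    (hT a b fun t ht => hab t (Finset.mem_union_left _ ht))
    (hT' a b fun t ht => hab t (Finset.mem_union_right _ ht))⟩

theorem IsSemialg.congr (h : IsSemialg Q) (hQ : ∀ a, Q' a ↔ Q a) : IsSemialg Q' :=
  let ⟨T, hT⟩ := h
  ⟨T, fun a b hab => by rw [hQ, hQ, hT a b hab]⟩

theorem IsSemialg.imp (h : IsSemialg Q) (h' : IsSemialg Q') : IsSemialg fun a => Q a → Q' a :=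
  (h.and h'.not).not.congr fun a => by tauto

theorem IsSemialg.iff (h : IsSemialg Q) (h' : IsSemialg Q') : IsSemialg fun a => (Q a ↔ Q' a) :=
  ((h.imp h').and (h'.imp h)).congr fun a => by tauto

theorem isSemialg_forall {ι : Type*} [Finite ι] {Q : ι → (α → R) → Prop}
    (h : ∀ i, IsSemialg (Q i)) : IsSemialg fun a => ∀ i, Q i a := by
  classical
  have := Fintype.ofFinite ι
  choose T hT using h
  exact ⟨Finset.univ.biUnion T, fun a b hab => forall_congr' fun i => hT i a b fun t ht =>
    hab t (Finset.mem_biUnion.2 ⟨i, Finset.mem_univ i, ht⟩)⟩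

theorem isSemialg_exists {ι : Type*} [Finite ι] {Q : ι → (α → R) → Prop}
    (h : ∀ i, IsSemialg (Q i)) : IsSemialg fun a => ∃ i, Q i a :=
  (isSemialg_forall fun i => (h i).not).not.congr fun a => by simp

theorem isSemialg_exists_mem {ι : Type*} {s : Finset ι} {Q : ι → (α → R) → Prop}
    (h : ∀ i, IsSemialg (Q i)) : IsSemialg fun a => ∃ i ∈ s, Q i a :=
  (isSemialg_exists fun i : s => h i).congr fun a => by simp

theorem isSemialg_forall_mem {ι : Type*} {s : Finset ι} {Q : ι → (α → R) → Prop}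
    (h : ∀ i, IsSemialg (Q i)) : IsSemialg fun a => ∀ i ∈ s, Q i a :=
  (isSemialg_forall fun i : s => h i).congr fun a => by simp

variable [IsStrictOrderedRing R]

theorem IsPolyFun.eq {f g : (α → R) → R} (hf : IsPolyFun f) (hg : IsPolyFun g) :
    IsSemialg fun a => f a = g a :=
  ((hf.sub hg).pos.not.and (hg.sub hf).pos.not).congr fun a => by
    rw [sub_pos, sub_pos, not_lt, not_lt, le_antisymm_iff]

theorem IsPolyFun.nonneg {f : (α → R) → R} (hf : IsPolyFun f) : IsSemialg fun a => 0 ≤ f a :=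
  (isPolyFun_zero.sub hf).pos.not.congr fun a => by rw [zero_sub, neg_pos, not_lt]

/-- Elimination from the field to itself: if `a` and `b` agree in enough signs, a witness for `a`
has a counterpart over `b` with the same joint signs. -/
theorem isSemialg_exists_fun (hR : PolyIVT R) [Finite β] {Q : (α → R) → (β → R) → Prop}
    (h : IsSemialg fun c : α ⊕ β → R => Q (fun i => c (Sum.inl i)) fun j => c (Sum.inr j)) :
    IsSemialg fun a => ∃ b, Q a b := by
  obtain ⟨T, hT⟩ := h
  obtain ⟨T', hT'⟩ := exists_sameSigns_sum hR hR β T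
  have key : ∀ a b : α → R, SameSigns T' a b → (∃ c, Q a c) → ∃ c, Q b c :=
    fun a b hab ⟨c, hc⟩ =>
      let ⟨d, hd⟩ := hT' a b hab c
      ⟨d, (hT _ _ hd).1 hc⟩
  exact ⟨T', fun a b hab => ⟨key a b hab, key b a fun t ht => (hab t ht).symm⟩⟩

theorem isSemialg_forall_fun (hR : PolyIVT R) [Finite β] {Q : (α → R) → (β → R) → Prop}
    (h : IsSemialg fun c : α ⊕ β → R => Q (fun i => c (Sum.inl i)) fun j => c (Sum.inr j)) :
    IsSemialg fun a => ∀ b, Q a b :=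
  (isSemialg_exists_fun hR (Q := fun a b => ¬ Q a b) h.not).not.congr fun a => by simp

end Semialgebraic

/-! ### O-minimal expansions of ordered fields are real closed -/

section OMinimal

open Polynomial Set

variable {𝓛 : FirstOrder.Language.{u, v}} {M : Type w} [Field M] [LinearOrder M] [𝓛.Structure M]

theorem IsOMinimalExpansion.definableFun_add (hM : IsOMinimalExpansion 𝓛 M) {α : Type*}
    {f g : (α → M) → M} (hf : (univ : Set M).DefinableFun 𝓛 f)
    (hg : (univ : Set M).DefinableFun 𝓛 g) :
    (univ : Set M).DefinableFun 𝓛 fun v => f v + g v := by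
  have h : (univ : Set M).DefinableFun 𝓛 (fun v : Fin 2 → M => v 0 + v 1) :=
    (hM.definable_add.mono (empty_subset _)).preimage_comp ![some 0, some 1, none]
  exact h.comp (g := fun v => ![f v, g v]) fun i => by fin_cases i; exacts [hf, hg]

theorem IsOMinimalExpansion.definableFun_mul (hM : IsOMinimalExpansion 𝓛 M) {α : Type*}
    {f g : (α → M) → M} (hf : (univ : Set M).DefinableFun 𝓛 f)
    (hg : (univ : Set M).DefinableFun 𝓛 g) :
    (univ : Set M).DefinableFun 𝓛 fun v => f v * g v := by
  have h : (univ : Set M).DefinableFun 𝓛 (fun v : Fin 2 → M => v 0 * v 1) :=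
    (hM.definable_mul.mono (empty_subset _)).preimage_comp ![some 0, some 1, none]
  exact h.comp (g := fun v => ![f v, g v]) fun i => by fin_cases i; exacts [hf, hg]

theorem IsOMinimalExpansion.definable_setOf_le (hM : IsOMinimalExpansion 𝓛 M) {α : Type*}
    {f g : (α → M) → M} (hf : (univ : Set M).DefinableFun 𝓛 f)
    (hg : (univ : Set M).DefinableFun 𝓛 g) :
    (univ : Set M).Definable 𝓛 {v | f v ≤ g v} :=
  Definable.preimage_map (F := fun v => ![f v, g v])
    (fun i => by fin_cases i; exacts [hf, hg]) (hM.definable_le.mono (empty_subset _))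

theorem IsOMinimalExpansion.definableFun_eval (hM : IsOMinimalExpansion 𝓛 M) (p : M[X]) :
    (univ : Set M).DefinableFun 𝓛 fun v : Fin 1 → M => p.eval (v 0) := by
  have hX : (univ : Set M).DefinableFun 𝓛 fun v : Fin 1 → M => v 0 := DefinableFun.proj 𝓛
  have hC : ∀ c : M, (univ : Set M).DefinableFun 𝓛 fun _ : Fin 1 → M => c := fun c =>
    FirstOrder.Language.definableFun_const 𝓛 (Fin 1) (mem_univ c)
  induction p using Polynomial.induction_on' with
  | add p q hp hq =>
    simp only [eval_add]
    exact hM.definableFun_add hp hq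
  | monomial n c =>
    simp only [eval_monomial]
    refine hM.definableFun_mul (hC c) ?_
    induction n with
    | zero => simpa using hC 1
    | succ n ih =>
      simp only [pow_succ]
      exact hM.definableFun_mul ih hX

variable [IsStrictOrderedRing M]

/-- Definable completeness: each nonempty piece bounded above has a supremum, and a finite union
takes the largest of these. -/
theorem IsOMinimalExpansion.exists_isLUB (hM : IsOMinimalExpansion 𝓛 M) {S : Set M}
    (hS : (univ : Set M).Definable₁ 𝓛 S) (hne : S.Nonempty) (hbdd : BddAbove S) :
    ∃ c, IsLUB S c := by
  obtain ⟨F, hF, rfl, hI⟩ := hM.oMinimal S hS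
  have key : ∀ I ∈ F, I.Nonempty → ∃ c, IsLUB I c := by
    intro I hIF hIne
    have hb : BddAbove I := hbdd.mono (subset_sUnion_of_mem hIF)
    rcases hI I hIF with ⟨a, rfl⟩ | ⟨a, b, rfl⟩ | ⟨a, rfl⟩ | ⟨a, rfl⟩ | rfl
    · exact ⟨a, isLUB_singleton⟩
    · exact ⟨b, isLUB_Ioo (nonempty_Ioo.1 hIne)⟩
    · exact ⟨a, isLUB_Iio⟩
    · exact absurd hb (not_bddAbove_Ioi a)
    · exact absurd hb not_bddAbove_univ
  clear hI hS
  induction F, hF using Set.Finite.induction_on with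
  | empty => simp at hne
  | @insert I F _ _ ih =>
    rw [sUnion_insert] at hne hbdd ⊢
    rcases I.eq_empty_or_nonempty with hI | hI
    · rw [hI, empty_union] at hne hbdd ⊢
      exact ih hne hbdd fun J hJ => key J (mem_insert_of_mem _ hJ)
    · obtain ⟨c, hc⟩ := key I (mem_insert _ _) hI
      rcases (⋃₀ F).eq_empty_or_nonempty with hF | hF
      · exact ⟨c, by rwa [hF, union_empty]⟩
      · obtain ⟨d, hd⟩ := ih hF (hbdd.mono subset_union_right)
          fun J hJ => key J (mem_insert_of_mem _ hJ)
        exact ⟨c ⊔ d, hc.union hd⟩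

/-- The root is the supremum of the points up to `b` where `p` is negative: a nonzero sign at the
supremum would persist nearby and contradict its choice. -/
theorem IsOMinimalExpansion.polyIVT (hM : IsOMinimalExpansion 𝓛 M) : PolyIVT M := by
  intro p a b hab ha hb
  set S : Set M := {x | x ≤ b ∧ ¬ 0 ≤ p.eval x} with hSdef
  have hS : (univ : Set M).Definable₁ 𝓛 S :=
    (hM.definable_setOf_le (DefinableFun.proj 𝓛 (i := (0 : Fin 1)))
      (FirstOrder.Language.definableFun_const 𝓛 (Fin 1) (mem_univ b))).inter
      (hM.definable_setOf_le (FirstOrder.Language.definableFun_const 𝓛 (Fin 1) (mem_univ 0))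
        (hM.definableFun_eval p)).compl
  obtain ⟨c, hc⟩ := hM.exists_isLUB hS ⟨a, hab.le, not_le.2 ha⟩ ⟨b, fun x hx => hx.1⟩
  have hac : a ≤ c := hc.1 ⟨hab.le, not_le.2 ha⟩
  have hcb : c ≤ b := hc.2 fun x hx => hx.1
  have hc0 : p.eval c = 0 := by
    rcases lt_trichotomy (p.eval c) 0 with h | h | h
    · exfalso
      have hlt : c < b := lt_of_le_of_ne hcb fun e => by rw [e] at h; exact h.not_gt hb
      obtain ⟨ε, hε, hh⟩ := (-p).exists_forall_abs_sub_lt_eval_pos c (by simpa using h)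
      obtain ⟨d, hd1, hd2⟩ := exists_between (lt_min hlt (lt_add_of_pos_right c hε))
      rw [lt_min_iff] at hd2
      have h1 := hh d (by rw [abs_lt]; constructor <;> linarith [hd2.2])
      rw [eval_neg] at h1
      exact hd1.not_ge (hc.1 ⟨hd2.1.le, not_le.2 (by linarith)⟩)
    · exact h
    · exfalso
      obtain ⟨ε, hε, hh⟩ := p.exists_forall_abs_sub_lt_eval_pos c h
      have : c ≤ c - ε := hc.2 fun x hx => by
        by_contra hlt
        have h1 := hc.1 hx
        exact hx.2 (hh x (by rw [abs_lt]; constructor <;> linarith)).le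
      linarith
  refine ⟨c, lt_of_le_of_ne hac fun e => ?_, lt_of_le_of_ne hcb fun e => ?_, hc0⟩
  · rw [← e] at hc0
    exact ha.ne hc0
  · rw [e] at hc0
    exact hb.ne' hc0

end OMinimal

/-! ### Transfer to the real algebraic elements -/

section RealAlgebraic

open MvPolynomial

variable {M : Type*} [Field M] [LinearOrder M] [IsStrictOrderedRing M]

/-- The root found in `M` is algebraic over the algebraic elements, hence over `ℚ`. -/
theorem PolyIVT.realAlgebraic (hM : PolyIVT M) : PolyIVT (algebraicClosure ℚ M) := by
  intro p a b hab ha hb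
  have he : ∀ x : algebraicClosure ℚ M,
      (p.map (algebraMap (algebraicClosure ℚ M) M)).eval (x : M) = ((p.eval x : algebraicClosure ℚ M) : M) := fun x =>
    Polynomial.eval_map_apply (algebraMap (algebraicClosure ℚ M) M) x
  obtain ⟨c, h1, h2, h3⟩ := hM (p.map (algebraMap (algebraicClosure ℚ M) M)) a b hab
    (by rw [he]; exact_mod_cast ha) (by rw [he]; exact_mod_cast hb)
  have hp : p ≠ 0 := fun h => by simp [h] at ha
  have hc : IsAlgebraic (algebraicClosure ℚ M) c :=
    ⟨p, hp, by rwa [Polynomial.aeval_def, Polynomial.eval₂_eq_eval_map]⟩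
  have hc' : IsAlgebraic ℚ c := by
    have := algebraicClosure.isAlgebraic ℚ M
    exact @IsAlgebraic.restrictScalars ℚ (algebraicClosure ℚ M) M _ _ _ (IntermediateField.algebra' _) _ _ _ _ this c hc
  let d : algebraicClosure ℚ M := ⟨c, mem_algebraicClosure_iff.2 hc'⟩
  refine ⟨d, h1, h2, ?_⟩
  have := he d
  rw [h3] at this
  exact_mod_cast this.symm

theorem IntermediateField.sign_aeval_coe (K : IntermediateField ℚ M) {α : Type*} (c : α → K)
    (t : MvPolynomial α ℤ) :
    SignType.sign (aeval (fun i => (c i : M)) t) = SignType.sign (aeval c t) := by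
  have h : aeval (fun i => (c i : M)) t = ((aeval c t : K) : M) := aeval_algebraMap_apply M c t
  rw [h]
  generalize aeval c t = y
  rcases lt_trichotomy y 0 with h | h | h
  · rw [sign_neg h, sign_neg (by exact_mod_cast h)]
  · rw [h, sign_zero, ZeroMemClass.coe_zero, sign_zero]
  · rw [sign_pos h, sign_pos (by exact_mod_cast h)]

/-- Elimination between `M` and its subfield of algebraic elements; the parameters `a` have the same
signs in both because the inclusion preserves order. -/
theorem PolyIVT.exists_realAlgebraic_sameSigns (hM : PolyIVT M) {α β : Type*} [Finite β]
    (T : Finset (MvPolynomial (α ⊕ β) ℤ)) (a : α → algebraicClosure ℚ M) (b : β → M) :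
    ∃ b' : β → algebraicClosure ℚ M, SameSigns T (Sum.elim (fun i => (a i : M)) b)
      (fun i => ((Sum.elim a b' i : algebraicClosure ℚ M) : M)) := by
  obtain ⟨T', hT'⟩ := exists_sameSigns_sum hM hM.realAlgebraic β T
  obtain ⟨b', hb'⟩ := hT' (fun i => (a i : M)) a
    (fun t _ => IntermediateField.sign_aeval_coe _ _ t) b
  exact ⟨b', fun t ht => by rw [IntermediateField.sign_aeval_coe]; exact hb' t ht⟩

/-- Finitely many sign conditions satisfied by a point of a real closed field are satisfied by a
point with real algebraic coordinates, without changing the coordinates that are real algebraic. -/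
theorem PolyIVT.exists_isAlgebraic_sameSigns (hM : PolyIVT M) {ι : Type*} [Finite ι]
    (T : Finset (MvPolynomial ι ℤ)) (a : ι → M) :
    ∃ b : ι → M, (∀ i, IsAlgebraic ℚ (b i)) ∧ (∀ i, IsAlgebraic ℚ (a i) → b i = a i) ∧
      SameSigns T a b := by
  classical
  -- The algebraic coordinates become parameters, and only the others are moved.
  obtain ⟨e, he₁, he₂⟩ : ∃ e : {i // IsAlgebraic ℚ (a i)} ⊕ {i // ¬ IsAlgebraic ℚ (a i)} ≃ ι,
      (∀ i, e (Sum.inl i) = i) ∧ ∀ i, e (Sum.inr i) = i :=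
    ⟨Equiv.sumCompl _, fun _ => rfl, fun _ => rfl⟩
  let a₀ : {i // IsAlgebraic ℚ (a i)} → algebraicClosure ℚ M := fun i =>
    ⟨a i, mem_algebraicClosure_iff.2 i.2⟩
  obtain ⟨b', hb'⟩ := hM.exists_realAlgebraic_sameSigns (T.image (rename e.symm)) a₀
    fun i => a i
  refine ⟨fun i => (Sum.elim a₀ b' (e.symm i) : algebraicClosure ℚ M), fun i =>
    mem_algebraicClosure_iff.1 (Subtype.prop _), fun i hi => ?_, ?_⟩
  · have : e.symm i = Sum.inl ⟨i, hi⟩ := by rw [Equiv.symm_apply_eq, he₁]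
    simp only [this]
    rfl
  · convert hb'.of_image_rename using 1
    ext i
    obtain ⟨j | j, rfl⟩ := e.surjective i
    · rw [Equiv.symm_apply_apply, he₁]
      rfl
    · rw [Equiv.symm_apply_apply, he₂]
      rfl

end RealAlgebraic

/-! ### Affine extension of vertex maps -/

section SimplicialMaps

variable {M : Type w} [Field M] [LinearOrder M] {k : ℕ}

theorem affineIndependent_coe_finset_iff {s : Finset (Fin k → M)} :
    AffineIndependent M ((↑) : s → (Fin k → M)) ↔ ∀ c : (Fin k → M) → M, ∑ a ∈ s, c a = 0 →
      ∑ a ∈ s, c a • a = 0 → ∀ a ∈ s, c a = 0 := by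
  classical
  rw [affineIndependent_iff]
  constructor
  · intro h c h1 h2 a ha
    refine h s.attach (fun a => c a) ?_ ?_ ⟨a, ha⟩ (Finset.mem_attach _ _)
    · rwa [Finset.sum_attach s c]
    · rwa [Finset.sum_attach s fun a => c a • a]
  · intro h t c h1 h2 a ha
    set d : (Fin k → M) → M := fun b => if hb : b ∈ s then
      (if (⟨b, hb⟩ : s) ∈ t then c ⟨b, hb⟩ else 0) else 0 with hd
    have hd' : ∀ b : s, d b = if b ∈ t then c b else 0 := fun b => by simp [hd]
    have := h d ?_ ?_ a a.2
    · rwa [hd', if_pos ha] at this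
    · rw [← Finset.sum_attach s, ← h1]
      simp only [hd', Finset.attach_eq_univ, Finset.sum_ite_mem, Finset.univ_inter]
    · rw [← Finset.sum_attach s, ← h2]
      simp only [hd', Finset.attach_eq_univ, ite_smul, zero_smul, Finset.sum_ite_mem,
        Finset.univ_inter]

theorem AffineIndependent.eq_of_sum_smul_eq {s : Finset (Fin k → M)}
    (hs : AffineIndependent M ((↑) : s → (Fin k → M))) {c d : (Fin k → M) → M}
    (h : ∑ a ∈ s, c a = ∑ a ∈ s, d a) (h' : ∑ a ∈ s, c a • a = ∑ a ∈ s, d a • a) :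
    ∀ a ∈ s, c a = d a := fun a ha =>
  sub_eq_zero.1 (affineIndependent_coe_finset_iff.1 hs (fun a => c a - d a)
    (by rw [Finset.sum_sub_distrib, h, sub_self])
    (by simp only [sub_smul, Finset.sum_sub_distrib, h', sub_self]) a ha)

theorem openSimplex_subset_closedSimplex (s : Finset (Fin k → M)) :
    openSimplex s ⊆ closedSimplex s := fun _ ⟨c, h1, h2⟩ => ⟨c, fun a ha => (h1 a ha).le, h2⟩

/-- This makes the affine extension well defined: a point of two closed simplexes lies in the
closure of a common face, and by affine independence its coordinates in both are those in the face,
extended by zero. -/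
theorem OpenComplex.sum_smul_eq_of_mem (L : OpenComplex M k) (f : (Fin k → M) → (Fin k → M))
    {s t : Finset (Fin k → M)} (hs : s ∈ L.simplexes) (ht : t ∈ L.simplexes)
    {c d : (Fin k → M) → M} (hc : ∀ a ∈ s, 0 ≤ c a) (hc1 : ∑ a ∈ s, c a = 1)
    (hd : ∀ a ∈ t, 0 ≤ d a) (hd1 : ∑ a ∈ t, d a = 1)
    (h : ∑ a ∈ s, c a • a = ∑ a ∈ t, d a • a) :
    ∑ a ∈ s, c a • f a = ∑ a ∈ t, d a • f a := by
  classical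
  set x := ∑ a ∈ s, c a • a with hx
  have hxs : x ∈ closedSimplex s := ⟨c, hc, hc1, rfl⟩
  have hxt : x ∈ closedSimplex t := ⟨d, hd, hd1, h.symm⟩
  rcases L.inter s hs t ht with h0 | ⟨r, -, hrs, hrt, hr⟩
  · exact absurd (h0 ▸ ⟨hxs, hxt⟩ : x ∈ (∅ : Set (Fin k → M))) (Set.notMem_empty x)
  · obtain ⟨e, he, he1, hex⟩ : x ∈ closedSimplex r := hr ▸ ⟨hxs, hxt⟩
    have key : ∀ u ∈ L.simplexes, r ⊆ u → ∀ b : (Fin k → M) → M, ∑ a ∈ u, b a = 1 →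
        ∑ a ∈ u, b a • a = x → ∑ a ∈ u, b a • f a = ∑ a ∈ r, e a • f a := by
      intro u hu hru b hb1 hbx
      have hbe := (L.indep u hu).eq_of_sum_smul_eq (c := b) (d := fun a => if a ∈ r then e a else 0)
        (by rw [hb1, Finset.sum_ite_mem, Finset.inter_eq_right.2 hru, he1])
        (by
          simp only [ite_smul, zero_smul]
          rw [hbx, Finset.sum_ite_mem, Finset.inter_eq_right.2 hru, hex])
      rw [Finset.sum_congr rfl fun a ha => by rw [hbe a ha]]
      simp only [ite_smul, zero_smul]
      rw [Finset.sum_ite_mem, Finset.inter_eq_right.2 hru]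
    rw [key s hs hrs c hc1 rfl, key t ht hrt d hd1 h.symm]

/-- A map of the vertices extends to a map that is affine on all closed simplexes. -/
theorem OpenComplex.exists_extension (L : OpenComplex M k) (f : (Fin k → M) → (Fin k → M)) :
    ∃ F : (Fin k → M) → (Fin k → M), ∀ s ∈ L.simplexes, ∀ c : (Fin k → M) → M,
      (∀ a ∈ s, 0 ≤ c a) → ∑ a ∈ s, c a = 1 → F (∑ a ∈ s, c a • a) = ∑ a ∈ s, c a • f a := by
  classical
  have h : ∀ x, ∃ y, ∀ s ∈ L.simplexes, ∀ c : (Fin k → M) → M, (∀ a ∈ s, 0 ≤ c a) →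
      ∑ a ∈ s, c a = 1 → ∑ a ∈ s, c a • a = x → y = ∑ a ∈ s, c a • f a := by
    intro x
    by_cases hx : ∃ s ∈ L.simplexes, x ∈ closedSimplex s
    · obtain ⟨s, hs, c, hc, hc1, hcx⟩ := hx
      exact ⟨∑ a ∈ s, c a • f a, fun t ht d hd hd1 hdx =>
        L.sum_smul_eq_of_mem f hs ht hc hc1 hd hd1 (hcx.trans hdx.symm)⟩
    · exact ⟨x, fun s hs c hc hc1 hcx => absurd ⟨s, hs, c, hc, hc1, hcx⟩ hx⟩
  choose F hF using h
  exact ⟨F, fun s hs c hc hc1 => hF _ s hs c hc hc1 rfl⟩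

section Topology

variable [IsStrictOrderedRing M] [TopologicalSpace M] [OrderTopology M]

/-- Lifting `a` to `(a, 1)` turns affine into linear independence. A linear left inverse of the
combination map then reads off the barycentric coordinates, as affine and hence continuous functions
on all of `M ^ k`. -/
theorem AffineIndependent.exists_continuous_coord {s : Finset (Fin k → M)}
    (hs : AffineIndependent M ((↑) : s → (Fin k → M))) :
    ∃ β : (Fin k → M) → (Fin k → M) → M, (∀ a, Continuous (β a)) ∧
      ∀ c : (Fin k → M) → M, ∑ a ∈ s, c a = 1 → ∀ a ∈ s, β a (∑ a ∈ s, c a • a) = c a := by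
  classical
  have hli : LinearIndependent M (fun a : s => ((a : Fin k → M), (1 : M))) := by
    rw [Fintype.linearIndependent_iff]
    intro g hg i
    have h := affineIndependent_iff.1 hs Finset.univ g
    rw [Prod.ext_iff, Prod.fst_sum, Prod.snd_sum] at hg
    exact h (by simpa using hg.2) (by simpa using hg.1) i (Finset.mem_univ i)
  obtain ⟨g, hg⟩ := LinearMap.exists_leftInverse_of_injective
    (Fintype.linearCombination M fun a : s => ((a : Fin k → M), (1 : M)))
    (LinearMap.ker_eq_bot.2 hli.fintypeLinearCombination_injective)
  refine ⟨fun a x => if ha : a ∈ s then g (x, 1) ⟨a, ha⟩ else 0, fun a => ?_, fun c hc a ha => ?_⟩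
  · by_cases ha : a ∈ s
    · simp only [ha, dif_pos]
      have h : ∀ x, g (x, 1) ⟨a, ha⟩ =
          ((LinearMap.proj ⟨a, ha⟩).comp (g.comp (LinearMap.inl M (Fin k → M) M))) x +
            g (0, 1) ⟨a, ha⟩ := fun x => by
        have : ((x, 1) : (Fin k → M) × M) = (x, 0) + (0, 1) := by simp
        rw [this, map_add]
        rfl
      exact ((LinearMap.continuous_on_pi _).add continuous_const).congr fun x => (h x).symm
    · simp only [ha, dif_neg, not_false_eq_true]
      exact continuous_const
  · have h := LinearMap.congr_fun hg (fun a : s => c a)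
    have h2 : Fintype.linearCombination M (fun a : s => ((a : Fin k → M), (1 : M)))
        (fun a : s => c a) = (∑ a ∈ s, c a • a, 1) := by
      rw [Fintype.linearCombination_apply, Prod.ext_iff, Prod.fst_sum, Prod.snd_sum]
      refine ⟨?_, ?_⟩
      · exact Finset.sum_coe_sort s fun a => c a • a
      · simpa using (Finset.sum_coe_sort s c).trans hc
    rw [LinearMap.comp_apply, h2] at h
    simp only [ha, dif_pos, h]
    rfl

theorem AffineIndependent.isClosed_closedSimplex {s : Finset (Fin k → M)}
    (hs : AffineIndependent M ((↑) : s → (Fin k → M))) : IsClosed (closedSimplex s) := by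
  obtain ⟨β, hβ, h⟩ := hs.exists_continuous_coord
  have : closedSimplex s =
      (⋂ a ∈ s, {x | 0 ≤ β a x}) ∩ ({x | ∑ a ∈ s, β a x = 1} ∩ {x | ∑ a ∈ s, β a x • a = x}) := by
    ext x
    simp only [Set.mem_inter_iff, Set.mem_iInter, Set.mem_ofPred_eq]
    constructor
    · rintro ⟨c, hc, hc1, rfl⟩
      refine ⟨fun a ha => by rw [h c hc1 a ha]; exact hc a ha, ?_, ?_⟩
      · rw [← hc1]
        exact Finset.sum_congr rfl fun a ha => by rw [h c hc1 a ha]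
      · exact Finset.sum_congr rfl fun a ha => by rw [h c hc1 a ha]
    · rintro ⟨h1, h2, h3⟩
      exact ⟨fun a => β a x, h1, h2, h3⟩
  rw [this]
  refine (isClosed_biInter fun a _ => isClosed_le continuous_const (hβ a)).inter
    ((isClosed_eq (continuous_finsetSum _ fun a _ => hβ a) continuous_const).inter
      (isClosed_eq (continuous_finsetSum _ fun a _ => (hβ a).smul continuous_const)
        continuous_id))

/-- The finitely many closed simplexes are closed sets covering the realization, so continuity on
each of them suffices. -/
theorem OpenComplex.continuousOn_extension (L : OpenComplex M k)
    {f F : (Fin k → M) → (Fin k → M)} (hF : ∀ s ∈ L.simplexes, ∀ c : (Fin k → M) → M,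
      (∀ a ∈ s, 0 ≤ c a) → ∑ a ∈ s, c a = 1 → F (∑ a ∈ s, c a • a) = ∑ a ∈ s, c a • f a) :
    ContinuousOn F L.realization := by
  have h : ContinuousOn F (⋃ s : L.simplexes, closedSimplex (s : Finset (Fin k → M))) := by
    refine (locallyFinite_of_finite _).continuousOn_iUnion
      (fun s => (L.indep s s.2).isClosed_closedSimplex) fun s => ?_
    obtain ⟨β, hβ, h⟩ := (L.indep s s.2).exists_continuous_coord
    have : Continuous fun x => ∑ a ∈ (s : Finset (Fin k → M)), β a x • f a :=
      continuous_finsetSum _ fun a _ => (hβ a).smul continuous_const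
    refine this.continuousOn.congr ?_
    rintro x ⟨c, hc, hc1, rfl⟩
    rw [hF s s.2 c hc hc1]
    exact Finset.sum_congr rfl fun a ha => by rw [h c hc1 a ha]
  refine h.mono fun x hx => ?_
  simp only [OpenComplex.realization, Set.mem_iUnion] at hx ⊢
  obtain ⟨s, hs, hxs⟩ := hx
  exact ⟨⟨s, hs⟩, openSimplex_subset_closedSimplex s hxs⟩

theorem OpenComplex.extension_leftInverse [DecidableEq M] {L L' : OpenComplex M k}
    {f g F G : (Fin k → M) → (Fin k → M)}
    (hF : ∀ s ∈ L.simplexes, ∀ c : (Fin k → M) → M,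
      (∀ a ∈ s, 0 ≤ c a) → ∑ a ∈ s, c a = 1 → F (∑ a ∈ s, c a • a) = ∑ a ∈ s, c a • f a)
    (hG : ∀ s ∈ L'.simplexes, ∀ c : (Fin k → M) → M,
      (∀ a ∈ s, 0 ≤ c a) → ∑ a ∈ s, c a = 1 → G (∑ a ∈ s, c a • a) = ∑ a ∈ s, c a • g a)
    (hf : ∀ s ∈ L.simplexes, s.image f ∈ L'.simplexes) (hgf : ∀ a ∈ L.vertices, g (f a) = a)
    {x : Fin k → M} (hx : x ∈ L.realization) : F x ∈ L'.realization ∧ G (F x) = x := by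
  simp only [OpenComplex.realization, Set.mem_iUnion] at hx
  obtain ⟨s, hs, c, hc, hc1, rfl⟩ := hx
  have hgs : ∀ a ∈ s, g (f a) = a := fun a ha => hgf a ⟨s, hs, ha⟩
  have hinj : Set.InjOn f s := fun a ha b hb hab => by rw [← hgs a ha, hab, hgs b hb]
  -- A general target module covers both the sum of the weights and the sums of weighted points.
  have hsum : ∀ {N : Type w} [AddCommMonoid N] [Module M N] (φ : (Fin k → M) → N),
      ∑ b ∈ s.image f, c (g b) • φ b = ∑ a ∈ s, c a • φ (f a) := fun φ => by
    rw [Finset.sum_image hinj]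
    exact Finset.sum_congr rfl fun a ha => by rw [hgs a ha]
  have h1 : ∑ b ∈ s.image f, c (g b) = 1 := by
    have := hsum fun _ => (1 : M)
    simpa [hc1] using this
  have h0 : ∀ b ∈ s.image f, 0 < c (g b) := by
    simp only [Finset.forall_mem_image]
    exact fun a ha => by rw [hgs a ha]; exact hc a ha
  have hFx : F (∑ a ∈ s, c a • a) = ∑ b ∈ s.image f, c (g b) • b := by
    rw [hF s hs c (fun a ha => (hc a ha).le) hc1]
    exact (hsum fun b => b).symm
  rw [hFx]
  refine ⟨?_, ?_⟩
  · simp only [OpenComplex.realization, Set.mem_iUnion]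
    exact ⟨s.image f, hf s hs, fun b => c (g b), h0, h1, rfl⟩
  · rw [hG _ (hf s hs) (fun b => c (g b)) (fun b hb => (h0 b hb).le) h1, hsum g]
    exact Finset.sum_congr rfl fun a ha => by rw [hgs a ha]

/-- A vertex map with an inverse that matches the simplexes induces a simplicial homeomorphism. -/
theorem OpenComplex.exists_simplicialHomeomorph {L L' : OpenComplex M k}
    (f g : (Fin k → M) → (Fin k → M))
    (hf : ∀ s ∈ L.simplexes, s.image f ∈ L'.simplexes)
    (hg : ∀ s ∈ L'.simplexes, s.image g ∈ L.simplexes)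
    (hgf : ∀ a ∈ L.vertices, g (f a) = a) (hfg : ∀ a ∈ L'.vertices, f (g a) = a) :
    ∃ ψ : SimplicialHomeomorph L L', ψ.vertexMap = f := by
  obtain ⟨F, hF⟩ := L.exists_extension f
  obtain ⟨G, hG⟩ := L'.exists_extension g
  have hFG := fun x (hx : x ∈ L.realization) => extension_leftInverse hF hG hf hgf hx
  have hGF := fun x (hx : x ∈ L'.realization) => extension_leftInverse hG hF hg hfg hx
  let e : L.realization ≃ₜ L'.realization :=
    { toFun := fun x => ⟨F x, (hFG x x.2).1⟩
      invFun := fun x => ⟨G x, (hGF x x.2).1⟩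
      left_inv := fun x => Subtype.ext (hFG x x.2).2
      right_inv := fun x => Subtype.ext (hGF x x.2).2
      continuous_toFun :=
        (continuousOn_iff_continuous_domRestrict.1 (L.continuousOn_extension hF)).subtype_mk _
      continuous_invFun :=
        (continuousOn_iff_continuous_domRestrict.1 (L'.continuousOn_extension hG)).subtype_mk _ }
  refine ⟨⟨e, f, ⟨?_, ?_, ?_⟩, ?_, ?_⟩, rfl⟩
  · rintro a ⟨s, hs, ha⟩
    exact ⟨s.image f, hf s hs, Finset.mem_image_of_mem f ha⟩
  · intro a ha b hb hab
    rw [← hgf a ha, hab, hgf b hb]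
  · rintro b ⟨s, hs, hb⟩
    exact ⟨g b, ⟨s.image g, hg s hs, Finset.mem_image_of_mem g hb⟩, hfg b ⟨s, hs, hb⟩⟩
  · intro s hsL
    refine ⟨hf s, fun h => ?_⟩
    have := hg _ h
    rw [Finset.image_image] at this
    rwa [Finset.image_congr (f := g ∘ f) (g := id) fun a ha => hgf a (hsL ha),
      Finset.image_id] at this
  · intro s hs c hc hc1 x hx
    change F x = _
    rw [hx, hF s hs c hc hc1]

end Topology

end SimplicialMaps

/-! ### Relative position of simplexes as a semialgebraic condition -/

section Configurations

variable {M : Type w} [Field M] [LinearOrder M] {k : ℕ} {ι : Type*}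

/-- The open simplex spanned by the members of the family `p` with indices in `s`. -/
def familyOpenSimplex (p : ι → Fin k → M) (s : Finset ι) : Set (Fin k → M) :=
  {y | ∃ c : ι → M, (∀ i ∈ s, 0 < c i) ∧ ∑ i ∈ s, c i = 1 ∧ ∀ j, ∑ i ∈ s, c i * p i j = y j}

/-- The closed simplex spanned by the members of the family `p` with indices in `s`. -/
def familyClosedSimplex (p : ι → Fin k → M) (s : Finset ι) : Set (Fin k → M) :=
  {y | ∃ c : ι → M, (∀ i ∈ s, 0 ≤ c i) ∧ ∑ i ∈ s, c i = 1 ∧ ∀ j, ∑ i ∈ s, c i * p i j = y j}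

/-- The members of the family `p` with indices in `s` are affinely independent. -/
def FamilyIndep (p : ι → Fin k → M) (s : Finset ι) : Prop :=
  ∀ c : ι → M, ∑ i ∈ s, c i = 0 → (∀ j, ∑ i ∈ s, c i * p i j = 0) → ∀ i ∈ s, c i = 0

/-- Weights on all of `M ^ k` are traded for weights on the index set, so that for finite `ι`
quantifying over them is quantifying over finitely many field elements. The predicate `C` serves for
open and closed simplexes. -/
theorem exists_coeff_image_iff [DecidableEq (Fin k → M)] {p : ι → Fin k → M}
    (hp : Function.Injective p) (s : Finset ι) (C : M → Prop) (y : Fin k → M) :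
    (∃ c : (Fin k → M) → M, (∀ a ∈ s.image p, C (c a)) ∧ ∑ a ∈ s.image p, c a = 1 ∧
      ∑ a ∈ s.image p, c a • a = y) ↔
      ∃ c : ι → M, (∀ i ∈ s, C (c i)) ∧ ∑ i ∈ s, c i = 1 ∧ ∀ j, ∑ i ∈ s, c i * p i j = y j := by
  simp only [Finset.forall_mem_image, Finset.sum_image hp.injOn]
  constructor
  · rintro ⟨c, h1, h2, rfl⟩
    exact ⟨fun i => c (p i), h1, h2, fun j => by simp [Finset.sum_apply]⟩
  · rintro ⟨c, h1, h2, h3⟩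
    refine ⟨Function.extend p c 0, ?_, ?_, ?_⟩
    · simpa only [hp.extend_apply] using h1
    · simpa only [hp.extend_apply] using h2
    · simp only [hp.extend_apply]
      ext j
      simpa [Finset.sum_apply] using h3 j

theorem openSimplex_image [DecidableEq (Fin k → M)] {p : ι → Fin k → M}
    (hp : Function.Injective p) (s : Finset ι) :
    openSimplex (s.image p) = familyOpenSimplex p s :=
  Set.ext fun y => exists_coeff_image_iff hp s (0 < ·) y

theorem closedSimplex_image [DecidableEq (Fin k → M)] {p : ι → Fin k → M}
    (hp : Function.Injective p) (s : Finset ι) :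
    closedSimplex (s.image p) = familyClosedSimplex p s :=
  Set.ext fun y => exists_coeff_image_iff hp s (0 ≤ ·) y

theorem affineIndependent_image_iff [DecidableEq (Fin k → M)] {p : ι → Fin k → M}
    (hp : Function.Injective p) (s : Finset ι) :
    AffineIndependent M ((↑) : ↥(s.image p) → (Fin k → M)) ↔
      FamilyIndep p s := by
  simp only [affineIndependent_coe_finset_iff, Finset.forall_mem_image,
    Finset.sum_image hp.injOn]
  constructor
  · intro h c h1 h2 i hi
    have := h (Function.extend p c 0) (by simpa only [hp.extend_apply] using h1) (by
      simp only [hp.extend_apply]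
      ext j
      simpa [Finset.sum_apply] using h2 j) hi
    rwa [hp.extend_apply] at this
  · intro h c h1 h2
    refine h (fun i => c (p i)) h1 fun j => ?_
    simpa [Finset.sum_apply] using congrFun h2 j

/-- Makes disjointness of closed simplexes the case `r = ∅` of `SameConfiguration.inter_iff`. -/
theorem closedSimplex_empty : closedSimplex (∅ : Finset (Fin k → M)) = ∅ :=
  Set.eq_empty_of_forall_notMem fun _ ⟨_, _, h, _⟩ => by simp at h

/-- The families `p` and `q` span simplexes in the same relative positions. -/
structure SameConfiguration (p q : ι → Fin k → M) : Prop where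
  eq_iff : ∀ i i', p i = p i' ↔ q i = q i'
  indep_iff : ∀ s, FamilyIndep p s ↔ FamilyIndep q s
  inter_iff : ∀ s t r,
    familyClosedSimplex p s ∩ familyClosedSimplex p t = familyClosedSimplex p r ↔
      familyClosedSimplex q s ∩ familyClosedSimplex q t = familyClosedSimplex q r
  union_iff : ∀ S T : Finset (Finset ι),
    ⋃ s ∈ S, familyOpenSimplex p s = ⋃ t ∈ T, familyOpenSimplex p t ↔
      ⋃ s ∈ S, familyOpenSimplex q s = ⋃ t ∈ T, familyOpenSimplex q t
  subset_iff : ∀ s t, familyOpenSimplex p s ⊆ familyOpenSimplex p t ↔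
    familyOpenSimplex q s ⊆ familyOpenSimplex q t

variable [IsStrictOrderedRing M] [Finite ι] {α : Type*}

theorem isSemialg_familyOpenSimplex (hM : PolyIVT M) {p : ι → Fin k → (α → M) → M}
    {y : Fin k → (α → M) → M} (hp : ∀ i j, IsPolyFun (p i j)) (hy : ∀ j, IsPolyFun (y j))
    (s : Finset ι) :
    IsSemialg fun a => (fun j => y j a) ∈ familyOpenSimplex (fun i j => p i j a) s := by
  refine isSemialg_exists_fun hM (IsSemialg.and ?_ (IsSemialg.and ?_ ?_))
  · exact isSemialg_forall_mem fun i => (isPolyFun_apply _).pos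
  · exact (isPolyFun_sum fun i => isPolyFun_apply _).eq isPolyFun_one
  · exact isSemialg_forall fun j =>
      (isPolyFun_sum fun i => (isPolyFun_apply _).mul (hp i j).comp_inl).eq (hy j).comp_inl

theorem isSemialg_familyClosedSimplex (hM : PolyIVT M) {p : ι → Fin k → (α → M) → M}
    {y : Fin k → (α → M) → M} (hp : ∀ i j, IsPolyFun (p i j)) (hy : ∀ j, IsPolyFun (y j))
    (s : Finset ι) :
    IsSemialg fun a => (fun j => y j a) ∈ familyClosedSimplex (fun i j => p i j a) s := by
  refine isSemialg_exists_fun hM (IsSemialg.and ?_ (IsSemialg.and ?_ ?_))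
  · exact isSemialg_forall_mem fun i => (isPolyFun_apply _).nonneg
  · exact (isPolyFun_sum fun i => isPolyFun_apply _).eq isPolyFun_one
  · exact isSemialg_forall fun j =>
      (isPolyFun_sum fun i => (isPolyFun_apply _).mul (hp i j).comp_inl).eq (hy j).comp_inl

theorem isSemialg_familyIndep (hM : PolyIVT M) {p : ι → Fin k → (α → M) → M}
    (hp : ∀ i j, IsPolyFun (p i j)) (s : Finset ι) :
    IsSemialg fun a => FamilyIndep (fun i j => p i j a) s := by
  refine isSemialg_forall_fun hM (IsSemialg.imp ?_ (IsSemialg.imp ?_ ?_))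
  · exact (isPolyFun_sum fun i => isPolyFun_apply _).eq isPolyFun_zero
  · exact isSemialg_forall fun j =>
      (isPolyFun_sum fun i => (isPolyFun_apply _).mul (hp i j).comp_inl).eq isPolyFun_zero
  · exact isSemialg_forall_mem fun i => (isPolyFun_apply _).eq isPolyFun_zero

/-- The family `p` is fixed, so each statement about it is a constant truth value; only the variable
family contributes polynomials, and these have integer coefficients even when `p` is not algebraic.
-/
theorem isSemialg_sameConfiguration (hM : PolyIVT M) (p : ι → Fin k → M) :
    IsSemialg fun x : ι × Fin k → M => SameConfiguration p fun i j => x (i, j) := by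
  have hq : ∀ (i : ι) (j : Fin k), IsPolyFun fun x : ι × Fin k → M => x (i, j) :=
    fun i j => isPolyFun_apply _
  have hq' : ∀ (i : ι) (j : Fin k),
      IsPolyFun fun x : (ι × Fin k) ⊕ Fin k → M => x (Sum.inl (i, j)) :=
    fun i j => isPolyFun_apply _
  have hy : ∀ j : Fin k, IsPolyFun fun x : (ι × Fin k) ⊕ Fin k → M => x (Sum.inr j) :=
    fun j => isPolyFun_apply _
  have h1 : IsSemialg fun x : ι × Fin k → M =>
      ∀ i i', p i = p i' ↔ (fun j => x (i, j)) = fun j => x (i', j) :=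
    isSemialg_forall fun i => isSemialg_forall fun i' => (isSemialg_const _).iff
      ((isSemialg_forall fun j => (hq i j).eq (hq i' j)).congr fun x => funext_iff)
  have h2 : IsSemialg fun x : ι × Fin k → M =>
      ∀ s, FamilyIndep p s ↔ FamilyIndep (fun i j => x (i, j)) s :=
    isSemialg_forall fun s => (isSemialg_const _).iff (isSemialg_familyIndep hM hq s)
  have h3 : IsSemialg fun x : ι × Fin k → M => ∀ s t r,
      familyClosedSimplex p s ∩ familyClosedSimplex p t = familyClosedSimplex p r ↔
        familyClosedSimplex (fun i j => x (i, j)) s ∩ familyClosedSimplex (fun i j => x (i, j)) t =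
          familyClosedSimplex (fun i j => x (i, j)) r :=
    isSemialg_forall fun s => isSemialg_forall fun t => isSemialg_forall fun r =>
      (isSemialg_const _).iff (IsSemialg.congr (isSemialg_forall_fun hM
        (((isSemialg_familyClosedSimplex hM hq' hy s).and
          (isSemialg_familyClosedSimplex hM hq' hy t)).iff
            (isSemialg_familyClosedSimplex hM hq' hy r))) fun x => Set.ext_iff)
  have h4 : IsSemialg fun x : ι × Fin k → M => ∀ S T : Finset (Finset ι),
      ⋃ s ∈ S, familyOpenSimplex p s = ⋃ t ∈ T, familyOpenSimplex p t ↔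
        ⋃ s ∈ S, familyOpenSimplex (fun i j => x (i, j)) s =
          ⋃ t ∈ T, familyOpenSimplex (fun i j => x (i, j)) t :=
    isSemialg_forall fun S => isSemialg_forall fun T =>
      (isSemialg_const _).iff (IsSemialg.congr (isSemialg_forall_fun hM
        (Q := fun x y => (∃ s ∈ S, y ∈ familyOpenSimplex (fun i j => x (i, j)) s) ↔
          ∃ t ∈ T, y ∈ familyOpenSimplex (fun i j => x (i, j)) t)
        ((isSemialg_exists_mem (s := S) fun s => isSemialg_familyOpenSimplex hM hq' hy s).iff
          (isSemialg_exists_mem (s := T) fun t => isSemialg_familyOpenSimplex hM hq' hy t)))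
            fun x => by simp only [Set.ext_iff, Set.mem_iUnion, exists_prop])
  have h5 : IsSemialg fun x : ι × Fin k → M => ∀ s t,
      familyOpenSimplex p s ⊆ familyOpenSimplex p t ↔
        familyOpenSimplex (fun i j => x (i, j)) s ⊆ familyOpenSimplex (fun i j => x (i, j)) t :=
    isSemialg_forall fun s => isSemialg_forall fun t =>
      (isSemialg_const _).iff (isSemialg_forall_fun hM
        ((isSemialg_familyOpenSimplex hM hq' hy s).imp (isSemialg_familyOpenSimplex hM hq' hy t)))
  exact (h1.and (h2.and (h3.and (h4.and h5)))).congr fun x =>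
    ⟨fun h => ⟨h.1, h.2, h.3, h.4, h.5⟩, fun h => ⟨h.1, h.2.1, h.2.2.1, h.2.2.2.1, h.2.2.2.2⟩⟩

/-- Every finite family of points can be moved to a family of real algebraic points in the same
configuration, keeping the points that are real algebraic. -/
theorem PolyIVT.exists_algebraic_sameConfiguration (hM : PolyIVT M) (p : ι → Fin k → M) :
    ∃ q : ι → Fin k → M, (∀ i, IsAlgebraicPoint (q i)) ∧
      (∀ i, IsAlgebraicPoint (p i) → q i = p i) ∧ SameConfiguration p q := by
  obtain ⟨T, hT⟩ := isSemialg_sameConfiguration hM p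
  obtain ⟨b, hb, hbp, hs⟩ := hM.exists_isAlgebraic_sameSigns T fun x => p x.1 x.2
  -- The condition holds at `p` itself, hence at `b`, which has the same signs.
  exact ⟨fun i j => b (i, j), fun i j => hb (i, j), fun i hi => funext fun j => hbp (i, j) (hi j),
    (hT _ b hs).1 ⟨fun _ _ => Iff.rfl, fun _ => Iff.rfl, fun _ _ _ => Iff.rfl, fun _ _ => Iff.rfl,
      fun _ _ => Iff.rfl⟩⟩

end Configurations

/-! ### Moving the vertices of the subdivision -/

theorem mainTheorem8 (𝓛 : FirstOrder.Language.{u, v}) (M : Type w)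
    [Field M] [LinearOrder M] [IsStrictOrderedRing M]
    [TopologicalSpace M] [OrderTopology M]
    [𝓛.Structure M] (hM : IsOMinimalExpansion 𝓛 M)
    (k : ℕ) (P L : OpenComplex M k)
    (hP : P.DefinedOverAlg) (hL : L.IsSubdivision P) :
    ∃ L' : OpenComplex M k,
      L'.IsSubdivision P ∧
      L'.DefinedOverAlg ∧
      (L.ContainsIntersections → L'.ContainsIntersections) ∧
      ∃ ψ : SimplicialHomeomorph L L',
        ∀ a ∈ L.vertices, IsAlgebraicPoint a → ψ.vertexMap a = a := by
  -- The vertices of `P` are included so that the configuration also records how `L` lies in `P`.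
  let V : Finset (Fin k → M) := (L.simplexes ∪ P.simplexes).biUnion id
  have hLV : ∀ s ∈ L.simplexes, s ⊆ V := fun s hs =>
    Finset.subset_biUnion_of_mem id (Finset.mem_union_left _ hs)
  have hPV : ∀ s ∈ P.simplexes, s ⊆ V := fun s hs =>
    Finset.subset_biUnion_of_mem id (Finset.mem_union_right _ hs)
  obtain ⟨q, hqalg, hqfix, hq⟩ :=
    hM.polyIVT.exists_algebraic_sameConfiguration fun a : V => (a : Fin k → M)
  have hp : Function.Injective fun a : V => (a : Fin k → M) := Subtype.val_injective
  have hqinj : Function.Injective q := fun i i' h => hp ((hq.eq_iff i i').2 h)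
  obtain ⟨f, hf⟩ : ∃ f : (Fin k → M) → (Fin k → M), ∀ i : V, f i = q i :=
    ⟨Function.extend (fun a : V => (a : Fin k → M)) q id, fun i => hp.extend_apply q id i⟩
  obtain ⟨g, hg⟩ : ∃ g : (Fin k → M) → (Fin k → M), ∀ i : V, g (q i) = i :=
    ⟨Function.extend q (fun a : V => (a : Fin k → M)) id, fun i => hqinj.extend_apply _ id i⟩
  let σ : Finset (Fin k → M) → Finset V := Finset.subtype (· ∈ V)
  have hσ : ∀ s ⊆ V, (σ s).image (fun a : V => (a : Fin k → M)) = s := fun s hs => by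
    ext a
    simp only [σ, Finset.mem_image, Finset.mem_subtype, Subtype.exists, exists_and_left,
      exists_prop, exists_eq_right_right]
    exact ⟨fun h => h.1, fun h => ⟨h, hs h⟩⟩
  have hσf : ∀ s ⊆ V, (σ s).image q = s.image f := fun s hs => by
    conv_rhs => rw [← hσ s hs, Finset.image_image]
    exact Finset.image_congr fun a _ => (hf a).symm
  have hopen : ∀ s ⊆ V, openSimplex s = familyOpenSimplex (fun a : V => (a : Fin k → M)) (σ s) ∧
      openSimplex (s.image f) = familyOpenSimplex q (σ s) := fun s hs =>
    ⟨by rw [← openSimplex_image hp, hσ s hs], by rw [← hσf s hs, openSimplex_image hqinj]⟩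
  have hclosed : ∀ s ⊆ V,
      closedSimplex s = familyClosedSimplex (fun a : V => (a : Fin k → M)) (σ s) ∧
      closedSimplex (s.image f) = familyClosedSimplex q (σ s) := fun s hs =>
    ⟨by rw [← closedSimplex_image hp, hσ s hs], by rw [← hσf s hs, closedSimplex_image hqinj]⟩
  have hinter : ∀ s t r, s ⊆ V → t ⊆ V → r ⊆ V →
      (closedSimplex s ∩ closedSimplex t = closedSimplex r ↔
        closedSimplex (s.image f) ∩ closedSimplex (t.image f) = closedSimplex (r.image f)) := by
    intro s t r hs ht hr
    rw [(hclosed s hs).1, (hclosed t ht).1, (hclosed r hr).1, (hclosed s hs).2, (hclosed t ht).2,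
      (hclosed r hr).2, hq.inter_iff]
  have hempty : ∀ s t, s ⊆ V → t ⊆ V → closedSimplex s ∩ closedSimplex t = ∅ →
      closedSimplex (s.image f) ∩ closedSimplex (t.image f) = ∅ := by
    intro s t hs ht h
    have := (hinter s t ∅ hs ht (Finset.empty_subset _)).1 (by rw [h, closedSimplex_empty])
    rwa [Finset.image_empty, closedSimplex_empty] at this
  -- The vertices of `P` are algebraic, hence fixed; this turns relations between the images of `L`
  -- and `P` into relations between `L'` and `P`.
  have hPf : ∀ s ∈ P.simplexes, s.image f = s := fun s hs => by
    conv_rhs => rw [← Finset.image_id (s := s)]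
    refine Finset.image_congr fun a ha => ?_
    exact (hf ⟨a, hPV s hs ha⟩).trans (hqfix ⟨a, hPV s hs ha⟩ (hP a ⟨s, hs, ha⟩))
  let L' : OpenComplex M k :=
    { simplexes := L.simplexes.image fun s => s.image f
      nonempty := by
        simp only [Finset.forall_mem_image]
        exact fun s hs => (L.nonempty s hs).image f
      indep := by
        simp only [Finset.forall_mem_image]
        intro s hs
        rw [← hσf s (hLV s hs), affineIndependent_image_iff hqinj, ← hq.indep_iff,
          ← affineIndependent_image_iff hp, hσ s (hLV s hs)]
        exact L.indep s hs
      inter := by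
        simp only [Finset.forall_mem_image]
        intro s hs t ht
        refine (L.inter s hs t ht).imp (hempty s t (hLV s hs) (hLV t ht)) ?_
        rintro ⟨r, hr, hrs, hrt, h⟩
        exact ⟨r.image f, hr.image f, Finset.image_subset_image hrs, Finset.image_subset_image hrt,
          (hinter s t r (hLV s hs) (hLV t ht) (hrs.trans (hLV s hs))).1 h⟩ }
  have hreal : ∀ Q : OpenComplex M k, (∀ s ∈ Q.simplexes, s ⊆ V) →
      Q.realization = ⋃ s ∈ Q.simplexes.image σ,
        familyOpenSimplex (fun a : V => (a : Fin k → M)) s ∧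
      ⋃ s ∈ Q.simplexes, openSimplex (s.image f) =
        ⋃ s ∈ Q.simplexes.image σ, familyOpenSimplex q s := by
    intro Q hQ
    rw [Finset.set_biUnion_finset_image, Finset.set_biUnion_finset_image]
    exact ⟨Set.iUnion₂_congr fun s hs => (hopen s (hQ s hs)).1,
      Set.iUnion₂_congr fun s hs => (hopen s (hQ s hs)).2⟩
  have hvert : ∀ b ∈ L'.vertices, ∃ i : V, b = q i := by
    rintro b ⟨t, ht, hb⟩
    obtain ⟨s, hs, rfl⟩ := Finset.mem_image.1 ht
    obtain ⟨a, ha, rfl⟩ := Finset.mem_image.1 hb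
    exact ⟨⟨a, hLV s hs ha⟩, hf ⟨a, hLV s hs ha⟩⟩
  refine ⟨L', ⟨?_, ?_⟩, ?_, ?_, ?_⟩
  · have h := hL.1
    rw [(hreal L hLV).1, (hreal P hPV).1, hq.union_iff, ← (hreal L hLV).2, ← (hreal P hPV).2] at h
    rw [OpenComplex.realization, Finset.set_biUnion_finset_image, h]
    exact Set.iUnion₂_congr fun s hs => by rw [hPf s hs]
  · simp only [L', Finset.forall_mem_image]
    intro s hs
    obtain ⟨t, ht, hst⟩ := hL.2 s hs
    refine ⟨t, ht, ?_⟩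
    rw [(hopen s (hLV s hs)).1, (hopen t (hPV t ht)).1, hq.subset_iff, ← (hopen s (hLV s hs)).2,
      ← (hopen t (hPV t ht)).2, hPf t ht] at hst
    exact hst
  · intro b hb
    obtain ⟨i, rfl⟩ := hvert b hb
    exact hqalg i
  · intro hC
    simp only [OpenComplex.ContainsIntersections, L', Finset.forall_mem_image]
    intro s hs t ht
    refine (hC s hs t ht).imp (hempty s t (hLV s hs) (hLV t ht)) ?_
    rintro ⟨r, hr, hrs, hrt, h⟩
    exact ⟨r.image f, Finset.mem_image_of_mem _ hr, Finset.image_subset_image hrs,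
      Finset.image_subset_image hrt, (hinter s t r (hLV s hs) (hLV t ht) (hLV r hr)).1 h⟩
  · have hgf : ∀ a ∈ V, g (f a) = a := fun a ha =>
      (congrArg g (hf ⟨a, ha⟩)).trans (hg ⟨a, ha⟩)
    obtain ⟨ψ, hψ⟩ := OpenComplex.exists_simplicialHomeomorph (L := L) (L' := L') f g
      (fun s hs => Finset.mem_image_of_mem _ hs)
      (by
        simp only [L', Finset.forall_mem_image]
        intro s hs
        rw [Finset.image_image, Finset.image_congr (f := g ∘ f) (g := id) fun a ha =>
          hgf a (hLV s hs ha), Finset.image_id]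
        exact hs)
      (fun a ⟨s, hs, ha⟩ => hgf a (hLV s hs ha))
      (fun b hb => by
        obtain ⟨i, rfl⟩ := hvert b hb
        rw [hg, hf])
    refine ⟨ψ, fun a ⟨s, hs, ha⟩ halg => ?_⟩
    rw [hψ]
    exact (hf ⟨a, hLV s hs ha⟩).trans (hqfix ⟨a, hLV s hs ha⟩ halg)
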